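/- All retract notions are those of metrizable spaces: a metrizable space $X$ is an AR-space (respectively ANR-space) if for every homeomorphism $h$ of $X$ onto a closed subset $h(X)$ of a metrizable space $Y$, the set $h(X)$ is a retract of $Y$ (respectively a retract of some neighbourhood of $h(X)$ in $Y$). An AR- (ANR-) compactum is a compact AR- (ANR-) space. For a compact Hausdorff space $X$ let $I(X)$ be the set of all functionals $\mu:C(X)\to\mathbb R$ with $\mu(\lambda_X)=\lambda$ (where $\lambda_X$ is the constant function $\lambda$), $\mu(\lambda+\varphi)=\lambda+\mu(\varphi)$ and $\mu(\max\{\varphi,\psi\})=\max\{\mu(\varphi),\mu(\psi)\}$ for all $\lambda\in\mathbb R$, $\varphi,\psi\in C(X)$, with the topology of pointwise convergence. Let $I_f(X)\subset I(X)$ be the subspace of all $\mu$ of the form $\mu(\varphi)=\max_{1\le i\le n}(\lambda_i+\varphi(x_i))$, where $n\ge 1$, the points $x_1,\dots,x_n\in X$ are distinct (so that they form the support of $\mu$), $\lambda_1,\dots,\lambda_n\in\mathbb R$, there is exactly one index $i_0$ with $\lambda_{i_0}=0$, and $\lambda_i\le-\ln(n+1)$ for all $i\ne i_0$. A continuous map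 $g:X\to Y$ of compact Hausdorff spaces induces the continuous map $I_f(g):I_f(X)\to I_f(Y)$, $I_f(g)(\mu)(\psi)=\mu(\psi\circ g)$. **Theorem.** If $X$ is an AR-compactum or an ANR-compactum, then $I_f(X)$ is an ANR-compactum (in particular it is compact and metrizable). In functorial form: the functor $I_f$ on compact Hausdorff spaces carries ANR-compacta to ANR-compacta. -/

import Mathlib

open Set Topology CategoryTheory

universe u

/-! ### Retracts, AR-spaces and ANR-spaces (in the class of metrizable spaces) -/

section Retracts

/-- `A` is a retract of the space `Y`: there is a continuous `r : Y → Y` with values in `A`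
that is the identity on `A`. -/
def IsRetractOf {Y : Type u} [TopologicalSpace Y] (A : Set Y) : Prop :=
  ∃ r : Y → Y, Continuous r ∧ (∀ y, r y ∈ A) ∧ ∀ a ∈ A, r a = a

/-- `A` is a neighbourhood retract of the space `Y`: there are an open `U ⊇ A` and a
retraction of `U` onto `A`. -/
def IsNhdRetractOf {Y : Type u} [TopologicalSpace Y] (A : Set Y) : Prop :=
  ∃ U : Set Y, IsOpen U ∧ A ⊆ U ∧
    ∃ r : Y → Y, ContinuousOn r U ∧ (∀ y ∈ U, r y ∈ A) ∧ ∀ a ∈ A, r a = a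

/-- Absolute retract: a metrizable space which is a retract of every metrizable space
in which it is embedded as a closed subset. -/
def IsAR (X : Type u) [TopologicalSpace X] : Prop :=
  TopologicalSpace.MetrizableSpace X ∧
    ∀ (Y : Type u) [TopologicalSpace Y] [TopologicalSpace.MetrizableSpace Y] (h : X → Y),
      IsClosedEmbedding h → IsRetractOf (range h)

/-- Absolute neighbourhood retract: a metrizable space which is a neighbourhood retract of
every metrizable space in which it is embedded as a closed subset. -/
def IsANR (X : Type u) [TopologicalSpace X] : Prop :=
  TopologicalSpace.MetrizableSpace X ∧
    ∀ (Y : Type u) [TopologicalSpace Y] [TopologicalSpace.MetrizableSpace Y] (h : X → Y),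
      IsClosedEmbedding h → IsNhdRetractOf (range h)

/-- An AR-compactum: a compact AR-space. -/
def IsARCompactum (X : Type u) [TopologicalSpace X] : Prop :=
  CompactSpace X ∧ IsAR X

/-- An ANR-compactum: a compact ANR-space. -/
def IsANRCompactum (X : Type u) [TopologicalSpace X] : Prop :=
  CompactSpace X ∧ IsANR X

end Retracts

/-! ### Idempotent probability measures -/

section IdempotentMeasures

/-- The space `I(X)` of idempotent (max-plus) probability measures on `X`, a set of functionals
`C(X) → ℝ`. As a type it carries the subspace topology of the product `ℝ ^ C(X)`. -/
def IdemMeasures (X : Type u) [TopologicalSpace X] : Set (C(X, ℝ) → ℝ) :=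
  {μ | (∀ c : ℝ, μ (ContinuousMap.const X c) = c) ∧
    (∀ (c : ℝ) (φ : C(X, ℝ)), μ (ContinuousMap.const X c + φ) = c + μ φ) ∧
    ∀ φ ψ : C(X, ℝ), μ (φ ⊔ ψ) = max (μ φ) (μ ψ)}

/-- The functional `I(f)(μ) : ψ ↦ μ (ψ ∘ f)`. -/
def idemMap {X Y : Type u} [TopologicalSpace X] [TopologicalSpace Y] (f : C(X, Y))
    (μ : C(X, ℝ) → ℝ) : C(Y, ℝ) → ℝ :=
  fun ψ => μ (ψ.comp f)

/-- The support of `μ`: the intersection of all closed `A ⊆ X` with `μ ∈ I(A)`, where `I(A)` is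
regarded as a subset of `I(X)` through the map induced by the inclusion `A → X`. -/
def idemSupp {X : Type u} [TopologicalSpace X] (μ : C(X, ℝ) → ℝ) : Set X :=
  ⋂₀ {A : Set X | IsClosed A ∧
    ∃ ν ∈ IdemMeasures A, idemMap (⟨Subtype.val, continuous_subtype_val⟩ : C(A, X)) ν = μ}

/-- `I_n(X)`: idempotent probability measures whose support has at most `n` points. -/
def IdemMeasuresN (n : ℕ) (X : Type u) [TopologicalSpace X] : Set (C(X, ℝ) → ℝ) :=
  {μ | μ ∈ IdemMeasures X ∧ (idemSupp μ).encard ≤ n}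

/-- `I_ω(X)`: idempotent probability measures with finite support. -/
def IdemMeasuresFin (X : Type u) [TopologicalSpace X] : Set (C(X, ℝ) → ℝ) :=
  {μ | ∃ n : ℕ, 1 ≤ n ∧ μ ∈ IdemMeasuresN n X}

/-- The max-plus combination `⨁_{x ∈ s} c x ⊙ δ_x`, that is, `φ ↦ max_{x ∈ s} (c x + φ x)`. -/
noncomputable def maxPlusComb {X : Type u} [TopologicalSpace X] (s : Finset X)
    (hs : s.Nonempty) (c : X → ℝ) : C(X, ℝ) → ℝ :=
  fun φ => s.sup' hs fun x => c x + φ x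

/-- `I_f(X)`: the measures `⨁_{i=1}^n c_i ⊙ δ_{x_i}` in `I_ω(X)` with support the `n` distinct
points `x_1, …, x_n`, with exactly one mass equal to `0` and with all other masses at most
`-ln (n + 1)`. -/
def IdemMeasuresF (X : Type u) [TopologicalSpace X] : Set (C(X, ℝ) → ℝ) :=
  {μ | μ ∈ IdemMeasuresFin X ∧
    ∃ (s : Finset X) (hs : s.Nonempty) (c : X → ℝ),
      idemSupp μ = s ∧ μ = maxPlusComb s hs c ∧
      ∃! x₀ : X, x₀ ∈ s ∧ c x₀ = 0 ∧
        ∀ x ∈ s, x ≠ x₀ → c x ≤ -Real.log ((s.card : ℝ) + 1)}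

theorem maxPlusComb_mem {X : Type u} [TopologicalSpace X] (s : Finset X) (hs : s.Nonempty)
    (c : X → ℝ) {x₀ : X} (hx₀ : x₀ ∈ s) (h0 : c x₀ = 0) (hc : ∀ x ∈ s, c x ≤ 0) :
    maxPlusComb s hs c ∈ IdemMeasures X := by
  have h1 : s.sup' hs c = 0 :=
    le_antisymm (Finset.sup'_le _ _ hc) (h0 ▸ Finset.le_sup' c hx₀)
  refine ⟨fun a => ?_, fun a φ => ?_, fun φ ψ => ?_⟩
  · apply le_antisymm
    · refine Finset.sup'_le _ _ fun x hx => ?_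
      have := hc x hx
      simpa using this
    · refine Finset.le_sup'_of_le _ hx₀ ?_
      simp [h0]
  · simp only [maxPlusComb]
    apply le_antisymm
    · refine Finset.sup'_le _ _ fun x hx => ?_
      have := Finset.le_sup' (fun x => c x + φ x) hx
      simp only [ContinuousMap.add_apply, ContinuousMap.const_apply]
      linarith
    · obtain ⟨x, hx, hx'⟩ := Finset.exists_mem_eq_sup' hs (fun x => c x + φ x)
      rw [hx']
      refine Finset.le_sup'_of_le _ hx ?_
      simp only [ContinuousMap.add_apply, ContinuousMap.const_apply]
      linarith
  · apply le_antisymm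
    · refine Finset.sup'_le _ _ fun x hx => ?_
      rw [ContinuousMap.sup_apply, ← max_add_add_left]
      exact max_le_max (Finset.le_sup' (fun x => c x + φ x) hx)
        (Finset.le_sup' (fun x => c x + ψ x) hx)
    · apply max_le
      · refine Finset.sup'_le _ _ fun x hx => Finset.le_sup'_of_le _ hx ?_
        simp
      · refine Finset.sup'_le _ _ fun x hx => Finset.le_sup'_of_le _ hx ?_
        simp

theorem idemSupp_maxPlusComb {X : Type u} [TopologicalSpace X] [CompactSpace X] [T2Space X]
    (s : Finset X) (hs : s.Nonempty) (c : X → ℝ) {x₀ : X} (hx₀ : x₀ ∈ s) (h0 : c x₀ = 0)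
    (hc : ∀ x ∈ s, c x ≤ 0) : idemSupp (maxPlusComb s hs c) = s := by
  apply Subset.antisymm
  · refine sInter_subset_of_mem ⟨s.finite_toSet.isClosed, ?_⟩
    refine ⟨maxPlusComb (X := (s : Set X)) s.attach (by simpa using hs) (fun x => c x),
      maxPlusComb_mem _ _ _ (x₀ := ⟨x₀, hx₀⟩) (by simp) h0 (fun x _ => hc x x.2), ?_⟩
    funext φ
    apply le_antisymm
    · refine Finset.sup'_le (by simpa using hs) _ fun x _ => ?_
      exact Finset.le_sup' (fun x => c x + φ x) x.2
    · refine Finset.sup'_le _ _ fun x hx => ?_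
      exact Finset.le_sup' (fun x : (s : Set X) => c x + φ x) (Finset.mem_attach s ⟨x, hx⟩)
  · rintro x hx A ⟨hA, ν, hν, hμ⟩
    by_contra hxA
    obtain ⟨g, hg0, hg1, -⟩ := exists_continuous_zero_one_of_isClosed hA
      (isClosed_singleton (x := x)) (disjoint_singleton_right.2 hxA)
    let φ : C(X, ℝ) := (1 - c x) • g
    have hz : φ.comp (⟨Subtype.val, continuous_subtype_val⟩ : C(A, X)) =
        ContinuousMap.const A 0 := by
      ext a
      have : g a = 0 := hg0 a.2
      simp [φ, this]
    have h1 : maxPlusComb s hs c φ = 0 := by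
      rw [← hμ, idemMap, hz, hν.1]
    have h2 : c x + φ x ≤ maxPlusComb s hs c φ := Finset.le_sup' (fun x => c x + φ x) hx
    have h3 : g x = 1 := hg1 rfl
    simp only [φ, ContinuousMap.smul_apply, h3, smul_eq_mul, mul_one, h1] at h2
    linarith

/-- The explicit description of `I_f(X)`: the points carrying the (real) masses of a max-plus
combination automatically form its support. -/
theorem mem_idemMeasuresF_iff {X : Type u} [TopologicalSpace X] [CompactSpace X] [T2Space X]
    {μ : C(X, ℝ) → ℝ} : μ ∈ IdemMeasuresF X ↔
      ∃ (s : Finset X) (hs : s.Nonempty) (c : X → ℝ), μ = maxPlusComb s hs c ∧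
        ∃ x₀ ∈ s, c x₀ = 0 ∧ ∀ x ∈ s, x ≠ x₀ → c x ≤ -Real.log ((s.card : ℝ) + 1) := by
  constructor
  · rintro ⟨-, s, hs, c, -, h, x₀, ⟨h1, h2, h3⟩, -⟩
    exact ⟨s, hs, c, h, x₀, h1, h2, h3⟩
  · rintro ⟨s, hs, c, rfl, x₀, h1, h2, h3⟩
    have hpos : 0 < Real.log ((s.card : ℝ) + 1) :=
      Real.log_pos (by have := hs.card_pos; simpa using this)
    have hc : ∀ x ∈ s, c x ≤ 0 := fun x hx => by
      by_cases h : x = x₀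
      · rw [h, h2]
      · linarith [h3 x hx h]
    have hsupp := idemSupp_maxPlusComb s hs c h1 h2 hc
    refine ⟨⟨s.card, hs.card_pos, maxPlusComb_mem s hs c h1 h2 hc, ?_⟩, s, hs, c, hsupp, rfl,
      x₀, ⟨h1, h2, h3⟩, ?_⟩
    · rw [hsupp, Set.encard_coe_eq_coe_finsetCard]
    · rintro y ⟨hy, hy0, -⟩
      by_contra h
      linarith [h3 y hy h]

theorem idemMap_mem_idemMeasuresF {X Y : Type u} [TopologicalSpace X] [CompactSpace X]
    [T2Space X] [TopologicalSpace Y] [CompactSpace Y] [T2Space Y] (f : C(X, Y))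
    {μ : C(X, ℝ) → ℝ} (hμ : μ ∈ IdemMeasuresF X) : idemMap f μ ∈ IdemMeasuresF Y := by
  classical
  obtain ⟨s, hs, c, rfl, x₀, h1, h2, h3⟩ := mem_idemMeasuresF_iff.1 hμ
  have key : ∀ y : Y, ∃ x : X, y ∈ s.image f →
      x ∈ s ∧ f x = y ∧ ∀ z ∈ s, f z = y → c z ≤ c x := by
    intro y
    by_cases hy : y ∈ s.image f
    · have hne : (s.filter fun z => f z = y).Nonempty := by
        obtain ⟨x, hx, hxy⟩ := Finset.mem_image.1 hy
        exact ⟨x, Finset.mem_filter.2 ⟨hx, hxy⟩⟩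
      obtain ⟨x, hx, hmax⟩ := Finset.exists_max_image _ c hne
      rw [Finset.mem_filter] at hx
      exact ⟨x, fun _ => ⟨hx.1, hx.2, fun z hz hzy => hmax z (Finset.mem_filter.2 ⟨hz, hzy⟩)⟩⟩
    · exact ⟨x₀, fun h => absurd h hy⟩
  choose g hg using key
  have hpos : 0 < Real.log ((s.card : ℝ) + 1) :=
    Real.log_pos (by have := hs.card_pos; simpa using this)
  have hy₀ : f x₀ ∈ s.image f := Finset.mem_image_of_mem f h1
  refine mem_idemMeasuresF_iff.2 ⟨s.image f, hs.image f, fun y => c (g y), ?_, f x₀, hy₀, ?_, ?_⟩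
  · funext ψ
    apply le_antisymm
    · refine Finset.sup'_le hs _ fun x hx => ?_
      have hfx : f x ∈ s.image f := Finset.mem_image_of_mem f hx
      refine Finset.le_sup'_of_le _ hfx ?_
      have := (hg _ hfx).2.2 x hx rfl
      simpa using this
    · refine Finset.sup'_le _ _ fun y hy => ?_
      refine Finset.le_sup'_of_le _ (hg y hy).1 ?_
      simp [(hg y hy).2.1]
  · by_cases h : g (f x₀) = x₀
    · simp [h, h2]
    · have a1 := (hg _ hy₀).2.2 x₀ h1 rfl
      have a2 := h3 _ (hg _ hy₀).1 h
      linarith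
  · intro y hy hne
    have hgy : g y ≠ x₀ := by
      intro h
      exact hne (by rw [← (hg y hy).2.1, h])
    refine (h3 _ (hg y hy).1 hgy).trans (neg_le_neg ?_)
    apply Real.log_le_log (by positivity)
    have := Finset.card_image_le (s := s) (f := f)
    have : ((s.image f).card : ℝ) ≤ s.card := by exact_mod_cast this
    linarith

/-- The functor `I_f`, on compact Hausdorff spaces and continuous maps: `X ↦ I_f(X)` and
`f ↦ (μ ↦ (ψ ↦ μ (ψ ∘ f)))`. -/
def idemFunctorF : CompHaus.{u} ⥤ TopCat.{u} where
  obj X := TopCat.of (IdemMeasuresF X)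
  map {X Y} f := TopCat.ofHom
    { toFun := fun μ => ⟨idemMap f.hom.hom μ.1, idemMap_mem_idemMeasuresF f.hom.hom μ.2⟩
      continuous_toFun := by
        refine Continuous.subtype_mk (continuous_pi fun ψ => ?_) _
        exact (continuous_apply (ψ.comp f.hom.hom)).comp continuous_subtype_val }
  map_id X := by
    ext μ
    rfl
  map_comp f g := by
    ext μ
    rfl

end IdempotentMeasures

/-! ### Absolute neighbourhood extensors -/

/-! A compact metrizable X embeds in the Hilbert cube Q, and if X is an ANR some neighbourhood U of
X in Q has a retraction r onto X. The conditions defining I_f survive two operations: moving the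
points by any map, and lowering (or deleting) the masses other than the mass 0 at the base point. So
the measures over Q whose base point lies in U retract onto I_f(X): move points by r and multiply
the weights of the other points by a cutoff that is 1 on X and 0 off a smaller neighbourhood. Points
at which r is not under control are thereby deleted, and only the base point has to stay in U. This
is `isANE_idemMeasuresF`; it reduces the theorem to showing that I_f(Q) is an absolute neighbourhood
extensor.

For the topology, masses are replaced by their exponentials, so that a mass tending to -∞ becomes a
weight tending to 0. The gap condition says that weights listed from the base point decay like 1 /
(i + 2), and this makes I_f(X) a continuous image of the compact space `seqWeights` × X^ℕ.
Compactness follows, and since the parametrization is a quotient map, also after taking the product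
with a parameter space, continuity of operations is checked on sequences of weights and points
(`continuousOn_idemOp`).

On I_f(Q), subtracting t from the other weights and killing high coordinates is a deformation which
at each time t > 0 lands in measures with boundedly many points in a finite-dimensional cube
(`cubeDeform_mem`). Such a finite level is a finite union of cells: listing the support
lexicographically removes the permutation symmetry, and fixing the first coordinate in which each
pair of points differs makes each cell a compact convex set of coordinates and weights. A measure on
the boundary of a cell has fewer support points or larger first differences, so it lies in an open
cell of smaller rank. Attaching cells one at a time by `IsANE.union_image` shows that the levels are
extensors, and the telescope `isANE_univ_of_deformations` carries this over to I_f(Q). -/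

section Extensors

open Filter

/-- A subset `Z` of a space `M` is an absolute neighbourhood extensor for metrizable spaces. -/
def IsANE.{w, v} {M : Type v} [TopologicalSpace M] (Z : Set M) : Prop :=
  ∀ (Y : Type w) [TopologicalSpace Y] [TopologicalSpace.MetrizableSpace Y] (A : Set Y)
    (f : Y → M), IsClosed A → ContinuousOn f A → MapsTo f A Z →
    ∃ U : Set Y, IsOpen U ∧ A ⊆ U ∧ ∃ F : Y → M, ContinuousOn F U ∧ MapsTo F U Z ∧ EqOn F f A

theorem isANE_empty.{w, v} {M : Type v} [TopologicalSpace M] : IsANE.{w} (∅ : Set M) := by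
  intro Y _ _ A f _ _ hf
  have hA : A = ∅ := eq_empty_of_forall_notMem fun a ha => hf ha
  exact ⟨∅, isOpen_empty, by simp [hA], f, by simp, by simp [MapsTo], by simp [hA]⟩

/-- A closed convex subset of a Hilbert space is a retract. -/
theorem Convex.exists_continuous_retraction {E : Type*} [NormedAddCommGroup E]
    [InnerProductSpace ℝ E] [CompleteSpace E] {D : Set E} (hne : D.Nonempty) (hcl : IsClosed D)
    (hconv : Convex ℝ D) :
    ∃ r : E → E, Continuous r ∧ (∀ x, r x ∈ D) ∧ ∀ x ∈ D, r x = x := by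
  choose r hr hmin using exists_norm_eq_iInf_of_complete_convex hne hcl.isComplete hconv
  have key : ∀ x, ∀ w ∈ D, inner ℝ (x - r x) (w - r x) ≤ 0 := fun x =>
    (norm_eq_iInf_iff_real_inner_le_zero hconv (hr x)).1 (hmin x)
  have hlip : LipschitzWith 1 r := by
    refine LipschitzWith.of_dist_le_mul fun x y => ?_
    have h1 := key x _ (hr y)
    have h2 := key y _ (hr x)
    -- The sum of the two variational inequalities for the nearest points; with Cauchy–Schwarz it
    -- makes `r` nonexpansive.
    have h3 : ‖r x - r y‖ ^ 2 ≤ inner ℝ (x - y) (r x - r y) := by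
      have e : inner ℝ (x - r x) (r y - r x) + inner ℝ (y - r y) (r x - r y) =
          ‖r x - r y‖ ^ 2 - inner ℝ (x - y) (r x - r y) := by
        rw [← real_inner_self_eq_norm_sq, ← neg_sub (r x) (r y), inner_neg_right,
          ← sub_eq_zero]
        simp only [inner_sub_left, inner_sub_right]
        ring
      linarith
    have h4 := real_inner_le_norm (x - y) (r x - r y)
    rw [NNReal.coe_one, one_mul, dist_eq_norm, dist_eq_norm]
    by_contra! h
    nlinarith [norm_nonneg (x - y), norm_nonneg (r x - r y)]
  refine ⟨r, hlip.continuous, hr, fun x hx => ?_⟩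
  have := key x x hx
  rw [real_inner_self_nonpos, sub_eq_zero] at this
  exact this.symm

/-- Maps into a closed convex set extend from a relatively closed subset of an open set. -/
theorem Convex.exists_extension_of_isClosed {E : Type*} [NormedAddCommGroup E]
    [InnerProductSpace ℝ E] [FiniteDimensional ℝ E] {D : Set E} (hne : D.Nonempty)
    (hcl : IsClosed D) (hconv : Convex ℝ D) {Y : Type*} [TopologicalSpace Y]
    [TopologicalSpace.MetrizableSpace Y] {A C : Set Y} (hA : IsClosed A) {f : Y → E}
    (hf : ContinuousOn f (A \ C)) (hfD : MapsTo f (A \ C) D) :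
    ∃ F : Y → E, ContinuousOn F Cᶜ ∧ (∀ y, F y ∈ D) ∧ EqOn F f (A \ C) := by
  classical
  obtain ⟨r, hr, hrD, hrid⟩ := hconv.exists_continuous_retraction hne hcl
  -- Tietze is applied in coordinates on the subspace `Cᶜ`, where the trace of `A` is closed; the
  -- result is then pushed into `D` by `r`.
  let e : E ≃L[ℝ] (Fin (Module.finrank ℝ E) → ℝ) := ContinuousLinearEquiv.ofFinrankEq (by simp)
  let S : Set (Cᶜ : Set Y) := Subtype.val ⁻¹' A
  have hS : IsClosed S := hA.preimage continuous_subtype_val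
  have hcont : Continuous fun y : S => e (f y.1.1) := by
    refine e.continuous.comp ?_
    exact hf.comp_continuous (continuous_subtype_val.comp continuous_subtype_val)
      fun y => ⟨y.2, y.1.2⟩
  obtain ⟨g, hg⟩ := ContinuousMap.exists_restrict_eq hS ⟨_, hcont⟩
  have hg' : ∀ y : (Cᶜ : Set Y), y ∈ S → g y = e (f y) := fun y hy =>
    congrArg (fun k : C(S, _) => k ⟨y, hy⟩) hg
  obtain ⟨x₀, hx₀⟩ := hne
  refine ⟨fun y => if h : y ∈ Cᶜ then r (e.symm (g ⟨y, h⟩)) else x₀, ?_, fun y => ?_, ?_⟩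
  · rw [continuousOn_iff_continuous_domRestrict]
    have : (Cᶜ).domRestrict (fun y => if h : y ∈ Cᶜ then r (e.symm (g ⟨y, h⟩)) else x₀) =
        fun y => r (e.symm (g y)) := by
      ext1 y
      simp only [Set.domRestrict_apply]
      rw [dif_pos y.2]
    rw [this]
    fun_prop
  · dsimp only
    split_ifs
    · exact hrD _
    · exact hx₀
  · intro y hy
    have h : y ∈ Cᶜ := hy.2
    simp only [dif_pos h]
    rw [hg' ⟨y, h⟩ hy.1]
    simp [hrid _ (hfD hy)]

/-- A closed neighbourhood retract of a compact convex set is a strong deformation retract of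
one of its neighbourhoods `{x | 1 / 2 ≤ v x}`. -/
theorem exists_deformation_of_isANE {E : Type} [NormedAddCommGroup E] [NormedSpace ℝ E]
    {D B : Set E} (hconv : Convex ℝ D) (hB : IsANE.{0} B) (hBc : IsClosed B) (hBD : B ⊆ D) :
    ∃ (d : ℝ × E → E) (v : E → ℝ), Continuous d ∧ Continuous v ∧
      (∀ s ∈ Icc (0 : ℝ) 1, ∀ x ∈ D, d (s, x) ∈ D) ∧ (∀ x, d (0, x) = x) ∧
      (∀ s, ∀ x ∈ B, d (s, x) = x) ∧ (∀ x ∈ B, v x = 1) ∧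
      ∀ x ∈ D, 1 / 2 ≤ v x → d (1, x) ∈ B := by
  obtain ⟨U, hU, hBU, ρ, hρ, hρB, hρid⟩ := hB E B id hBc continuousOn_id fun x hx => hx
  obtain ⟨V, hV, hBV, hVU⟩ := normal_exists_closure_subset hBc hU hBU
  obtain ⟨v, hv0, hv1, hv⟩ := exists_continuous_zero_one_of_isClosed hV.isClosed_compl hBc
    (disjoint_compl_left_iff_subset.2 hBV)
  -- The deformation runs along the segments from `x` to `ρ x`, slowed by `w`: it is complete where
  -- `v` is at least `1 / 2`, and it is constant off `V`, so the lack of continuity of `ρ` off `U`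
  -- is harmless.
  let w : E → ℝ := fun x => min 1 (2 * v x)
  have hw : Continuous w := by fun_prop
  have hw01 : ∀ x, w x ∈ Icc (0 : ℝ) 1 := fun x =>
    ⟨le_min zero_le_one (by linarith [(hv x).1]), min_le_left _ _⟩
  have hwV : ∀ x ∉ V, w x = 0 := fun x hx => by
    have : v x = 0 := hv0 hx
    simp [w, this]
  have hc : Continuous fun x => w x • (ρ x - x) := by
    rw [continuous_iff_continuousAt]
    intro x
    by_cases hx : x ∈ U
    · exact hw.continuousAt.smul ((hρ.continuousAt (hU.mem_nhds hx)).sub continuousAt_id)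
    · have hxV : x ∈ (closure V)ᶜ := fun h => hx (hVU h)
      refine (continuousAt_const (y := (0 : E))).congr ?_
      filter_upwards [isClosed_closure.isOpen_compl.mem_nhds hxV] with y hy
      rw [hwV y fun h => hy (subset_closure h), zero_smul]
  refine ⟨fun p => p.2 + p.1 • (w p.2 • (ρ p.2 - p.2)), v, ?_, v.continuous, ?_, ?_, ?_, ?_, ?_⟩
  · exact continuous_snd.add (continuous_fst.smul (hc.comp continuous_snd))
  · intro s hs x hx
    by_cases hxU : x ∈ U
    · have : x + s • (w x • (ρ x - x)) = x + (s * w x) • (ρ x - x) := by rw [smul_smul]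
      simp only [this]
      exact hconv.add_smul_sub_mem hx (hBD (hρB hxU))
        ⟨mul_nonneg hs.1 (hw01 x).1, mul_le_one₀ hs.2 (hw01 x).1 (hw01 x).2⟩
    · simp [hwV x fun h => hxU (hVU (subset_closure h)), hx]
  · intro x
    simp
  · intro s x hx
    simp [hρid hx]
  · exact fun x hx => hv1 hx
  · intro x hx hvx
    have hxV : x ∈ V := by
      by_contra h
      have : v x = 0 := hv0 h
      linarith
    have hw1 : w x = 1 := min_eq_left (by linarith)
    simpa [hw1] using hρB (hVU (subset_closure hxV))

theorem IsClosed.exists_continuous_zero_set {Y : Type*} [MetricSpace Y] {C : Set Y}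
    (hC : IsClosed C) :
    ∃ ρ : Y → ℝ, Continuous ρ ∧ (∀ y ∈ C, ρ y = 0) ∧ ∀ y ∉ C, 0 < ρ y := by
  rcases C.eq_empty_or_nonempty with rfl | hne
  · exact ⟨fun _ => 1, continuous_const, by simp, by simp⟩
  · exact ⟨fun y => Metric.infDist y C, Metric.continuous_infDist_pt C,
      fun y hy => Metric.infDist_zero_of_mem hy,
      fun y hy => (hC.notMem_iff_infDist_pos hne).1 hy⟩

/-- Urysohn's lemma in the subspace `Cᶜ`: `A \ C` is closed there, though not in `Y`, and nothing is
claimed about continuity at `C`. -/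
theorem IsOpen.exists_urysohn_rel {Y : Type*} [TopologicalSpace Y]
    [TopologicalSpace.MetrizableSpace Y] {A C O : Set Y} (hA : IsClosed A) (hO : IsOpen O)
    (hAO : A \ C ⊆ O) :
    ∃ v : Y → ℝ, ContinuousOn v Cᶜ ∧ (∀ y, v y ∈ Icc (0 : ℝ) 1) ∧ (∀ y ∈ A \ C, v y = 0) ∧
      ∀ y, y ∉ C → y ∉ O → v y = 1 := by
  classical
  obtain ⟨g, h0, h1, h01⟩ := exists_continuous_zero_one_of_isClosed (X := (Cᶜ : Set Y))
    (hA.preimage continuous_subtype_val) (hO.isClosed_compl.preimage continuous_subtype_val)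
    (by
      rw [Set.disjoint_left]
      exact fun y hy hyO => hyO (hAO ⟨hy, y.2⟩))
  refine ⟨fun y => if h : y ∈ Cᶜ then g ⟨y, h⟩ else 0, ?_, fun y => ?_, ?_, ?_⟩
  · rw [continuousOn_iff_continuous_domRestrict]
    have : (Cᶜ).domRestrict (fun y => if h : y ∈ Cᶜ then g ⟨y, h⟩ else 0) = g := by
      ext1 y
      simp only [Set.domRestrict_apply]
      rw [dif_pos y.2]
    rw [this]
    fun_prop
  · dsimp only
    split_ifs
    · exact h01 _
    · simp
  · intro y hy
    have h : y ∈ Cᶜ := hy.2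
    simp only [dif_pos h]
    exact h0 (x := ⟨y, h⟩) hy.1
  · intro y hy hyO
    have h : y ∈ Cᶜ := hy
    simp only [dif_pos h]
    exact h1 (x := ⟨y, h⟩) hyO

/-- The preimage of `S` may accumulate at `C`, where `g` is not controlled; adjoining `C` repairs
closedness. -/
theorem ContinuousOn.isClosed_union_inter_preimage {Y X : Type*} [TopologicalSpace Y]
    [TopologicalSpace X] {C : Set Y} (hC : IsClosed C) {g : Y → X} (hg : ContinuousOn g Cᶜ)
    {S : Set X} (hS : IsClosed S) : IsClosed (C ∪ (Cᶜ ∩ g ⁻¹' S)) := by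
  have : (C ∪ (Cᶜ ∩ g ⁻¹' S))ᶜ = Cᶜ ∩ g ⁻¹' Sᶜ := by
    ext y
    by_cases hy : y ∈ C <;> simp [hy]
  rw [← isOpen_compl_iff, this]
  exact hg.isOpen_inter_preimage hC.isOpen_compl hS.isOpen_compl

end Extensors

/-! ### Attaching a convex cell to an absolute neighbourhood extensor -/

section Adjunction

open Filter

theorem continuousWithinAt_iff_ultrafilter_le {α β : Type*} [TopologicalSpace α]
    [TopologicalSpace β] {f : α → β} {s : Set α} {x : α} :
    ContinuousWithinAt f s x ↔
      ∀ g : Ultrafilter α, ↑g ≤ 𝓝[s] x → Tendsto f g (𝓝 (f x)) :=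
  tendsto_iff_ultrafilter _ _ _

/-- Attaching a compact convex set to an absolute neighbourhood extensor along a closed absolute
neighbourhood extensor gives an absolute neighbourhood extensor. -/
theorem IsANE.union_image {M : Type*} [TopologicalSpace M] [T2Space M] {E : Type}
    [NormedAddCommGroup E] [InnerProductSpace ℝ E] [FiniteDimensional ℝ E] {Z : Set M}
    (hZ : IsANE.{u} Z) (hZc : IsClosed Z) {D B : Set E} (hD : IsCompact D) (hconv : Convex ℝ D)
    (hB : IsANE.{0} B) (hBc : IsClosed B) (hBD : B ⊆ D) {q : E → M} (hq : ContinuousOn q D)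
    (hqB : MapsTo q B Z) (hdisj : ∀ x ∈ D, q x ∈ Z → x ∈ B) (hinj : InjOn q (D \ B)) :
    IsANE.{u} (Z ∪ q '' D) := by
  classical
  rcases D.eq_empty_or_nonempty with rfl | hDne
  · simpa using hZ
  intro Y _ _ A f hA hf hfZ
  let _ : MetricSpace Y := TopologicalSpace.metrizableSpaceMetric Y
  obtain ⟨d, v, hd, hv, hdD, hd0, hdB, hvB, hvd⟩ := exists_deformation_of_isANE hconv hB hBc hBD
  -- `C` is the part of `A` already sent to `Z`. Off `C`, the map `f` lifts through `q` to `D`. The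
  -- plan is to follow the lift, deformed towards `B`, close to `A`, and to hand over to an
  -- extension with values in `Z` once the deformation is complete.
  set C : Set Y := A ∩ f ⁻¹' Z with hCdef
  have hC : IsClosed C := hf.preimage_isClosed_of_isClosed hA hZc
  have hCA : C ⊆ A := inter_subset_left
  have hCo : IsOpen Cᶜ := hC.isOpen_compl
  obtain ⟨ρ, hρ, hρ0, hρpos⟩ := hC.exists_continuous_zero_set
  have hlift : ∀ y : Y, ∃ x : E, y ∈ A \ C → x ∈ D ∧ q x = f y := by
    intro y
    by_cases hy : y ∈ A \ C
    · rcases hfZ hy.1 with h | ⟨x, hx, hxy⟩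
      · exact absurd ⟨hy.1, h⟩ hy.2
      · exact ⟨x, fun _ => ⟨hx, hxy⟩⟩
    · exact ⟨0, fun h => absurd h hy⟩
  choose f₁ hf₁ using hlift
  have hf₁B : ∀ y ∈ A \ C, f₁ y ∉ B := fun y hy h =>
    hy.2 ⟨hy.1, by
      have := hqB h
      rwa [(hf₁ y hy).2] at this⟩
  -- By compactness of `D` it suffices that `f₁ y` is the only cluster point of `f₁` at `y`: any
  -- cluster point lies over `f y`, hence outside `B`, where `q` is injective.
  have hf₁c : ContinuousOn f₁ (A \ C) := by
    intro y hy
    refine hD.tendsto_nhds_of_unique_mapClusterPt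
      (eventually_nhdsWithin_of_forall fun z hz => (hf₁ z hz).1) fun x hx hcl => ?_
    obtain ⟨𝒰, h𝒰, hlim⟩ := mapClusterPt_iff_ultrafilter.1 hcl
    have hmem : ∀ᶠ z in (𝒰 : Filter Y), z ∈ A \ C := h𝒰 self_mem_nhdsWithin
    have h1 : Tendsto (fun z => q (f₁ z)) 𝒰 (𝓝 (q x)) :=
      (hq x hx).tendsto.comp (tendsto_nhdsWithin_iff.2 ⟨hlim, hmem.mono fun z hz => (hf₁ z hz).1⟩)
    have h2 : Tendsto f 𝒰 (𝓝 (f y)) :=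
      ((hf y hy.1).mono sdiff_subset).tendsto.mono_left h𝒰
    have h3 : q x = f y := by
      refine tendsto_nhds_unique h1 (h2.congr' ?_)
      filter_upwards [hmem] with z hz using (hf₁ z hz).2.symm
    have hxB : x ∉ B := fun h => hy.2 ⟨hy.1, by
      have := hqB h
      rwa [h3] at this⟩
    exact hinj ⟨hx, hxB⟩ ⟨(hf₁ y hy).1, hf₁B y hy⟩ (h3.trans (hf₁ y hy).2.symm)
  obtain ⟨φ, hφ, hφD, hφf⟩ := hconv.exists_extension_of_isClosed hDne hD.isClosed hA hf₁c
    fun y hy => (hf₁ y hy).1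
  have hqφ : ∀ y ∈ A \ C, q (φ y) = f y := fun y hy => by rw [hφf hy, (hf₁ y hy).2]
  -- The extended lift `φ` is arbitrary near `C`. On `O` it is tied to its values on `A \ C`, with
  -- error at most `ρ`, and `ρ` vanishes on `C`.
  let O : Set Y := {y | y ∉ C ∧ ∃ a ∈ A \ C, dist y a < ρ y ∧ dist (φ y) (φ a) < ρ y}
  have hO : IsOpen O := by
    have : O = ⋃ a ∈ A \ C, (Cᶜ ∩ (fun y => dist y a - ρ y) ⁻¹' Iio 0) ∩
        (Cᶜ ∩ (fun y => dist (φ y) (φ a) - ρ y) ⁻¹' Iio 0) := by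
      ext y
      simp only [O, mem_iUnion, mem_ofPred_eq, mem_inter_iff, mem_preimage, mem_Iio, sub_neg,
        mem_compl_iff, exists_prop]
      tauto
    rw [this]
    refine isOpen_biUnion fun a _ => IsOpen.inter ?_ ?_
    · exact hCo.inter (isOpen_Iio.preimage (by fun_prop))
    · exact ContinuousOn.isOpen_inter_preimage
        ((continuous_id.dist continuous_const).comp_continuousOn hφ |>.sub hρ.continuousOn) hCo isOpen_Iio
  have hAO : A \ C ⊆ O := fun y hy => ⟨hy.2, y, hy, by simpa using hρpos y hy.2,
    by simpa using hρpos y hy.2⟩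
  obtain ⟨w, hw, hw01, hw0, hw1⟩ := IsOpen.exists_urysohn_rel hA hO hAO
  -- Within `O`, every limit of `φ` at `a ∈ C` is a limit of lifts, so it lies over `f a` and
  -- therefore in `B`.
  have hult : ∀ a ∈ C, ∀ 𝒰 : Ultrafilter Y, ↑𝒰 ≤ 𝓝[O] a →
      ∃ x ∈ B, q x = f a ∧ Tendsto φ 𝒰 (𝓝 x) := by
    intro a ha 𝒰 h𝒰
    obtain ⟨x, hx, hlim⟩ := hD.ultrafilter_le_nhds (𝒰.map φ)
      (le_principal_iff.2 (Ultrafilter.mem_map.2 (Filter.univ_mem' hφD)))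
    have hlim : Tendsto φ 𝒰 (𝓝 x) := hlim
    have hmem : ∀ᶠ y in (𝒰 : Filter Y), y ∈ O := h𝒰 self_mem_nhdsWithin
    have hsel : ∀ y : Y, ∃ b : Y, y ∈ O →
        b ∈ A \ C ∧ dist y b < ρ y ∧ dist (φ y) (φ b) < ρ y := by
      intro y
      by_cases hy : y ∈ O
      · obtain ⟨b, hb⟩ := hy.2
        exact ⟨b, fun _ => hb⟩
      · exact ⟨y, fun h => absurd h hy⟩
    choose b hb using hsel
    have hid : Tendsto id (𝒰 : Filter Y) (𝓝 a) := h𝒰.trans nhdsWithin_le_nhds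
    have hρlim : Tendsto ρ 𝒰 (𝓝 0) := by
      have := (hρ.tendsto a).comp hid
      rwa [hρ0 a ha] at this
    have hblim : Tendsto b 𝒰 (𝓝 a) := by
      refine (tendsto_iff_of_dist ?_).1 hid
      refine squeeze_zero' (Eventually.of_forall fun _ => dist_nonneg) ?_ hρlim
      filter_upwards [hmem] with y hy using (hb y hy).2.1.le
    have hφb : Tendsto (fun y => φ (b y)) 𝒰 (𝓝 x) := by
      refine (tendsto_iff_of_dist ?_).1 hlim
      refine squeeze_zero' (Eventually.of_forall fun _ => dist_nonneg) ?_ hρlim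
      filter_upwards [hmem] with y hy using (hb y hy).2.2.le
    have h1 : Tendsto (fun y => q (φ (b y))) 𝒰 (𝓝 (q x)) :=
      (hq x hx).tendsto.comp
        (tendsto_nhdsWithin_iff.2 ⟨hφb, Eventually.of_forall fun _ => hφD _⟩)
    have h2 : Tendsto (fun y => f (b y)) 𝒰 (𝓝 (f a)) :=
      (hf a ha.1).tendsto.comp
        (tendsto_nhdsWithin_iff.2 ⟨hblim, hmem.mono fun y hy => (hb y hy).1.1⟩)
    have h3 : q x = f a := by
      refine tendsto_nhds_unique h1 (h2.congr' ?_)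
      filter_upwards [hmem] with y hy using (hqφ _ (hb y hy).1).symm
    exact ⟨x, hdisj x hx (by rw [h3]; exact ha.2), h3, hlim⟩
  have hs01 : ∀ y, min 1 (2 * w y) ∈ Icc (0 : ℝ) 1 := fun y =>
    ⟨le_min zero_le_one (by linarith [(hw01 y).1]), min_le_left _ _⟩
  -- The factor 2 finishes the deformation at `w = 1 / 2`, well inside `O`; the range above `1 / 2`
  -- is left to a map into `Z`.
  let G : Y → M := fun y => q (d (min 1 (2 * w y), φ y))
  have hG : ContinuousOn G Cᶜ := by
    refine hq.comp (hd.comp_continuousOn ?_) fun y _ => hdD _ (hs01 y) _ (hφD y)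
    exact (continuousOn_const.inf (continuousOn_const.mul hw)).prodMk hφ
  let H : Y → M := fun y => if y ∈ C then f y else G y
  have hHC : ∀ y ∈ C, H y = f y := fun y hy => if_pos hy
  have hHG : ∀ y ∉ C, H y = G y := fun y hy => if_neg hy
  have hH : ContinuousOn H (C ∪ O) := by
    intro y hy
    by_cases hyC : y ∈ C
    · refine ContinuousWithinAt.union ?_ ?_
      · exact ((hf y hyC.1).mono hCA).congr (fun z hz => hHC z hz) (hHC y hyC)
      · rw [continuousWithinAt_iff_ultrafilter_le]
        intro 𝒰 h𝒰
        obtain ⟨x, hx, hqx, hlim⟩ := hult y hyC 𝒰 h𝒰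
        -- The limiting time `t` plays no role, since `d` fixes the points of `B` at all times.
        obtain ⟨t, ht, htlim⟩ := (isCompact_Icc (a := (0 : ℝ)) (b := 1)).ultrafilter_le_nhds
          (𝒰.map fun y => min 1 (2 * w y)) (le_principal_iff.2 (Ultrafilter.mem_map.2 (Filter.univ_mem' hs01)))
        have htlim : Tendsto (fun y => min 1 (2 * w y)) 𝒰 (𝓝 t) := htlim
        have h1 : Tendsto (fun y => d (min 1 (2 * w y), φ y)) 𝒰 (𝓝 x) := by
          have := (hd.tendsto (t, x)).comp (htlim.prodMk_nhds hlim)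
          rwa [hdB t x hx] at this
        have h2 : Tendsto G 𝒰 (𝓝 (q x)) :=
          (hq x (hBD hx)).tendsto.comp (tendsto_nhdsWithin_iff.2
            ⟨h1, Eventually.of_forall fun z => hdD _ (hs01 z) _ (hφD z)⟩)
        rw [hHC y hyC, ← hqx]
        refine h2.congr' ?_
        have hmem : ∀ᶠ y in (𝒰 : Filter Y), y ∈ O := h𝒰 self_mem_nhdsWithin
        filter_upwards [hmem] with z hz using (hHG z hz.1).symm
    · refine ContinuousAt.continuousWithinAt ?_
      refine (hG.continuousAt (hCo.mem_nhds hyC)).congr ?_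
      filter_upwards [hCo.mem_nhds hyC] with z hz using (hHG z hz).symm
  have hpair : ContinuousOn (fun y => (w y, v (φ y))) Cᶜ := hw.prodMk (hv.comp_continuousOn hφ)
  -- The interface: where `w = 1 / 2` the deformation is complete, so `H` takes values in `Z` as
  -- long as `v ∘ φ` is at least `1 / 2`.
  let C₂ : Set Y := C ∪ (Cᶜ ∩ (fun y => (w y, v (φ y))) ⁻¹' ({1 / 2} ×ˢ Ici (1 / 2)))
  have hC₂ : IsClosed C₂ :=
    hpair.isClosed_union_inter_preimage hC (isClosed_singleton.prod isClosed_Ici)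
  have hwO : ∀ y ∉ C, w y ≤ 1 / 2 → y ∈ O := by
    intro y hy hwy
    by_contra h
    linarith [hw1 y hy h]
  have hC₂O : C₂ ⊆ C ∪ O := by
    rintro y (hy | ⟨hy, h1, -⟩)
    · exact Or.inl hy
    · exact Or.inr (hwO y hy (le_of_eq h1))
  have hHC₂ : MapsTo H C₂ Z := by
    rintro y (hy | ⟨hy, h1, h2⟩)
    · rw [hHC y hy]
      exact hy.2
    · have h1 : w y = 1 / 2 := h1
      have h2 : 1 / 2 ≤ v (φ y) := h2
      rw [hHG y hy]
      have : min 1 (2 * w y) = 1 := by rw [h1]; norm_num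
      simp only [G, this]
      exact hqB (hvd _ (hφD y) h2)
  obtain ⟨U₂, hU₂, hCU₂, Φ, hΦ, hΦZ, hΦH⟩ := hZ Y C₂ H hC₂ (hH.mono hC₂O) hHC₂
  -- Where the two pieces can be glued. It is a neighbourhood of `C` because within `O` the limits
  -- of `φ` at `C` lie in `B`, where `v = 1`; so nearby points with `w = 1 / 2` belong to `C₂`, on
  -- which `H` and `Φ` agree.
  let G₀ : Set Y := {y | y ∈ U₂ ∧ (y ∉ C → w y = 1 / 2 → 1 / 2 < v (φ y))}
  have hG₀ : C ⊆ interior G₀ := by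
    intro a ha
    rw [mem_interior_iff_mem_nhds]
    have h1 : ∀ᶠ y in 𝓝[O] a, 1 / 2 < v (φ y) := by
      rw [Filter.Eventually, mem_iff_ultrafilter]
      intro 𝒰 h𝒰
      obtain ⟨x, hx, -, hlim⟩ := hult a ha 𝒰 h𝒰
      refine ((hv.tendsto x).comp hlim).eventually (lt_mem_nhds ?_)
      rw [hvB x hx]
      norm_num
    rw [eventually_nhdsWithin_iff] at h1
    filter_upwards [h1, hU₂.mem_nhds (hCU₂ (Or.inl ha))] with y hy hyU
    exact ⟨hyU, fun hyC hwy => hy (hwO y hyC hwy.le)⟩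
  let P₁ : Set Y := C ∪ (Cᶜ ∩ w ⁻¹' Iic (1 / 2))
  let P₂ : Set Y := C ∪ (Cᶜ ∩ w ⁻¹' Ici (1 / 2))
  have hP₁ : IsClosed P₁ := hw.isClosed_union_inter_preimage hC isClosed_Iic
  have hP₂ : IsClosed P₂ := hw.isClosed_union_inter_preimage hC isClosed_Ici
  have hP : ∀ y, y ∈ P₁ ∨ y ∈ P₂ := by
    intro y
    by_cases hy : y ∈ C
    · exact Or.inl (Or.inl hy)
    · rcases le_total (w y) (1 / 2) with h | h
      · exact Or.inl (Or.inr ⟨hy, h⟩)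
      · exact Or.inr (Or.inr ⟨hy, h⟩)
  let V : Set Y := (Cᶜ ∩ w ⁻¹' Iio (1 / 2)) ∪ interior G₀
  have hV : IsOpen V := (hw.isOpen_inter_preimage hCo isOpen_Iio).union isOpen_interior
  let F : Y → M := fun y => if y ∈ P₁ then H y else Φ y
  have hFP₁ : ∀ y ∈ P₁, F y = H y := fun y hy => if_pos hy
  have hVP₂ : ∀ y ∈ V, y ∈ P₂ → y ∈ interior G₀ := by
    rintro y (hy | hy) hyP
    · rcases hyP with h | h
      · exact absurd h hy.1
      · exact absurd (show w y < 1 / 2 from hy.2) (not_lt.2 h.2)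
    · exact hy
  have hFP₂ : ∀ y ∈ V, y ∈ P₂ → F y = Φ y := by
    intro y hy hyP
    by_cases h1 : y ∈ P₁
    · rw [hFP₁ y h1]
      refine (hΦH ?_).symm
      by_cases hyC : y ∈ C
      · exact Or.inl hyC
      · have e1 : w y ≤ 1 / 2 := (h1.resolve_left hyC).2
        have e2 : 1 / 2 ≤ w y := (hyP.resolve_left hyC).2
        have e3 := le_antisymm e1 e2
        exact Or.inr ⟨hyC, e3, ((interior_subset (hVP₂ y hy hyP)).2 hyC e3).le⟩
    · exact if_neg h1
  have hP₁O : P₁ ⊆ C ∪ O := by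
    rintro y (hy | hy)
    · exact Or.inl hy
    · exact Or.inr (hwO y hy.1 hy.2)
  refine ⟨V, hV, ?_, F, ?_, ?_, ?_⟩
  · intro y hy
    by_cases hyC : y ∈ C
    · exact Or.inr (hG₀ hyC)
    · left
      refine ⟨hyC, ?_⟩
      rw [mem_preimage, hw0 y ⟨hy, hyC⟩]
      norm_num
  · intro y hy
    have hsub : V ⊆ (V ∩ P₁) ∪ (V ∩ P₂) := fun z hz => (hP z).imp (⟨hz, ·⟩) (⟨hz, ·⟩)
    refine ContinuousWithinAt.mono (ContinuousWithinAt.union ?_ ?_) hsub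
    · by_cases h1 : y ∈ P₁
      · exact ((hH y (hP₁O h1)).mono (inter_subset_right.trans hP₁O)).congr
          (fun z hz => hFP₁ z hz.2) (hFP₁ y h1)
      · refine continuousWithinAt_of_notMem_closure fun h => h1 ?_
        exact hP₁.closure_subset_iff.2 inter_subset_right h
    · by_cases h2 : y ∈ P₂
      · refine ((hΦ y (interior_subset (hVP₂ y hy h2)).1).mono ?_).congr
          (fun z hz => hFP₂ z hz.1 hz.2) (hFP₂ y hy h2)
        exact fun z hz => (interior_subset (hVP₂ z hz.1 hz.2)).1
      · refine continuousWithinAt_of_notMem_closure fun h => h2 ?_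
        exact hP₂.closure_subset_iff.2 inter_subset_right h
  · intro y hy
    rcases hP y with h | h
    · rw [hFP₁ y h]
      by_cases hyC : y ∈ C
      · rw [hHC y hyC]
        exact Or.inl hyC.2
      · rw [hHG y hyC]
        exact Or.inr ⟨_, hdD _ (hs01 y) _ (hφD y), rfl⟩
    · rw [hFP₂ y hy h]
      exact Or.inl (hΦZ (interior_subset (hVP₂ y hy h)).1)
  · intro y hy
    by_cases hyC : y ∈ C
    · rw [hFP₁ y (Or.inl hyC), hHC y hyC]
    · have hwy := hw0 y ⟨hy, hyC⟩
      rw [hFP₁ y (Or.inr ⟨hyC, by rw [mem_preimage, hwy]; norm_num⟩), hHG y hyC]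
      simp only [G, hwy, mul_zero, min_eq_right zero_le_one, hd0]
      exact hqφ y ⟨hy, hyC⟩

end Adjunction

/-! ### Finite unions of convex sets and finite cell decompositions -/

section Cells

/-- The last set meets the union of the others in a finite union of compact convex sets with one
member fewer, so the induction, run over all families `K`, also handles the attaching set. -/
theorem isANE_biUnion_convex {E : Type} [NormedAddCommGroup E] [InnerProductSpace ℝ E]
    [FiniteDimensional ℝ E] {ι : Type*} (s : Finset ι) (K : ι → Set E)
    (hK : ∀ i ∈ s, IsCompact (K i)) (hconv : ∀ i ∈ s, Convex ℝ (K i)) :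
    IsANE.{0} (⋃ i ∈ s, K i) := by
  classical
  induction s using Finset.induction_on generalizing K with
  | empty => simpa using isANE_empty
  | insert a s _ ih =>
    have hs := fun i (hi : i ∈ s) => hK i (Finset.mem_insert_of_mem hi)
    have hs' := fun i (hi : i ∈ s) => hconv i (Finset.mem_insert_of_mem hi)
    have ha := hK a (Finset.mem_insert_self a s)
    have ha' := hconv a (Finset.mem_insert_self a s)
    have hcl : ∀ L : ι → Set E, (∀ i ∈ s, IsCompact (L i)) → IsClosed (⋃ i ∈ s, L i) :=
      fun L hL => (s.isCompact_biUnion hL).isClosed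
    have hinter : ∀ i ∈ s, IsCompact (K i ∩ K a) := fun i hi => (hs i hi).inter ha
    have := (ih K hs hs').union_image (hcl K hs) ha ha'
      (ih (fun i => K i ∩ K a) hinter fun i hi => (hs' i hi).inter ha')
      (hcl _ hinter) (iUnion₂_subset fun i _ => inter_subset_right) (q := id) continuousOn_id
      (fun x hx => by
        simp only [mem_iUnion, id] at hx ⊢
        obtain ⟨i, hi, hx⟩ := hx
        exact ⟨i, hi, hx.1⟩)
      (fun x hx hxZ => by
        simp only [mem_iUnion, id] at hxZ ⊢
        obtain ⟨i, hi, hxi⟩ := hxZ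
        exact ⟨i, hi, hxi, hx⟩)
      (injOn_id _)
    rw [image_id] at this
    rwa [Finset.set_biUnion_insert, union_comm]

/-- A space with a finite decomposition into compact convex cells, each attached along an absolute
neighbourhood extensor to the cells of smaller rank, is an absolute neighbourhood extensor. -/
theorem isANE_iUnion_cells {M : Type*} [TopologicalSpace M] [T2Space M] {E : Type}
    [NormedAddCommGroup E] [InnerProductSpace ℝ E] [FiniteDimensional ℝ E] {ι : Type*} [Finite ι]
    {α : Type*} [LinearOrder α] (rank : ι → α) (D B : ι → Set E) (q : ι → E → M)
    (hD : ∀ i, IsCompact (D i)) (hconv : ∀ i, Convex ℝ (D i)) (hB : ∀ i, IsANE.{0} (B i))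
    (hBc : ∀ i, IsClosed (B i)) (hBD : ∀ i, B i ⊆ D i) (hq : ∀ i, ContinuousOn (q i) (D i))
    (hinj : ∀ i j, ∀ x ∈ D i \ B i, ∀ y ∈ D j \ B j, q i x = q j y → i = j ∧ x = y)
    (hrank : ∀ i, ∀ x ∈ B i, ∃ j, rank j < rank i ∧ ∃ y ∈ D j \ B j, q i x = q j y) :
    IsANE.{u} (⋃ i, q i '' D i) := by
  classical
  cases nonempty_fintype ι
  -- The induction runs over sets of cells closed under passing to smaller rank, removing a cell of
  -- maximal rank; the boundary of that cell is then attached to cells already present.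
  have key : ∀ s : Finset ι, (∀ c ∈ s, ∀ c', rank c' < rank c → c' ∈ s) →
      IsANE.{u} (⋃ i ∈ s, q i '' D i) := by
    intro s
    induction s using Finset.induction_on_max_value rank with
    | empty => intro _; simpa using isANE_empty
    | insert a s has hmax ih =>
      intro hs
      have hs' : ∀ c, rank c < rank a → c ∈ s := fun c hc => by
        rcases Finset.mem_insert.1 (hs a (Finset.mem_insert_self a s) c hc) with rfl | h
        · exact absurd hc (lt_irrefl _)
        · exact h
      have hZ := ih fun c hc c' hlt => hs' c' (hlt.trans_le (hmax c hc))
      have hZc : IsClosed (⋃ i ∈ s, q i '' D i) :=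
        (s.isCompact_biUnion fun i _ => (hD i).image_of_continuousOn (hq i)).isClosed
      have := hZ.union_image hZc (hD a) (hconv a) (hB a) (hBc a) (hBD a) (hq a)
        (fun x hx => by
          obtain ⟨j, hj, y, hy, hxy⟩ := hrank a x hx
          rw [hxy]
          exact mem_biUnion (hs' j hj) (mem_image_of_mem _ hy.1))
        -- An interior point of the new cell cannot be identified with a point of an old one: any
        -- old point is represented in some open cell of rank at most that of its cell, and open
        -- cells are disjoint.
        (fun x hx hxZ => by
          by_contra hxB
          simp only [mem_iUnion] at hxZ
          obtain ⟨i, hi, y, hy, hxy⟩ := hxZ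
          by_cases hyB : y ∈ B i
          · obtain ⟨j, hj, z, hz, hyz⟩ := hrank i y hyB
            obtain ⟨rfl, -⟩ := hinj a j x ⟨hx, hxB⟩ z hz (hxy.symm.trans hyz)
            exact absurd (hmax i hi) (not_le.2 hj)
          · obtain ⟨rfl, -⟩ := hinj a i x ⟨hx, hxB⟩ y ⟨hy, hyB⟩ hxy.symm
            exact has hi)
        (fun x hx y hy hxy => (hinj a a x hx y hy hxy).2)
      rwa [Finset.set_biUnion_insert, union_comm]
  simpa using key Finset.univ fun _ _ _ _ => Finset.mem_univ _

end Cells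

/-! ### From small deformations into extensors to the whole space -/

section Telescope

open Filter

theorem exists_isClosed_nhdSet {Y : Type*} [TopologicalSpace Y] [NormalSpace Y] {A U : Set Y}
    (hA : IsClosed A) (hU : IsOpen U) (hAU : A ⊆ U) :
    ∃ C, IsClosed C ∧ A ⊆ interior C ∧ C ⊆ U := by
  obtain ⟨V, hV, hAV, hVU⟩ := normal_exists_closure_subset hA hU hAU
  exact ⟨closure V, isClosed_closure, hAV.trans (interior_maximal subset_closure hV), hVU⟩

theorem isOpen_forall_mem_compact {Y T : Type*} [TopologicalSpace Y] [TopologicalSpace T]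
    {K : Set T} (hK : IsCompact K) {W : Set (Y × T)} (hW : IsOpen W) :
    IsOpen {y | ∀ t ∈ K, (y, t) ∈ W} := by
  rw [isOpen_iff_mem_nhds]
  intro y hy
  obtain ⟨u, v, hu, -, hyu, hKv, huv⟩ := generalized_tube_lemma (isCompact_singleton (x := y)) hK hW
    (by
      rintro ⟨a, t⟩ ⟨rfl, ht⟩
      exact hy t ht)
  filter_upwards [hu.mem_nhds (hyu rfl)] with z hz t ht
  exact huv ⟨hz, hKv ht⟩

/-- One step of the extension of the homotopy `H` on a neighbourhood of `A`. -/
theorem IsANE.exists_slab {M : Type*} [MetricSpace M] {H : ℝ × M → M} (hH : Continuous H)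
    {Z Z' : Set M} (hZ' : IsANE.{u} Z') (hZZ' : Z ⊆ Z') {Y : Type u} [MetricSpace Y] {A : Set Y}
    (hA : IsClosed A) {f : Y → M} (hf : ContinuousOn f A) {a b δ : ℝ} (hab : a ≤ b) (hδ : 0 < δ)
    (hHZ : ∀ t ∈ Icc a b, ∀ x, H (t, x) ∈ Z') {C : Set Y} {g : Y → M} (hC : IsClosed C)
    (hAC : A ⊆ interior C) (hg : ContinuousOn g C) (hgZ : MapsTo g C Z)
    (hgA : ∀ y ∈ A, g y = H (b, f y)) :
    ∃ (C' : Set Y) (F : Y × ℝ → M), IsClosed C' ∧ A ⊆ interior C' ∧ C' ⊆ C ∧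
      ContinuousOn F (C' ×ˢ Icc a b) ∧ MapsTo F (C' ×ˢ Icc a b) Z' ∧
      (∀ y ∈ C', F (y, b) = g y) ∧ (∀ y ∈ A, ∀ t ∈ Icc a b, F (y, t) = H (t, f y)) ∧
      ∀ y ∈ C', ∀ t ∈ Icc a b, ∃ x ∈ A, dist y x < δ ∧ dist (F (y, t)) (H (t, f x)) < δ := by
  classical
  -- The data to be extended over the slab: the homotopy `H` of `f` over `A`, and the previously
  -- built map at the upper end `b`.
  let S₁ : Set (Y × ℝ) := A ×ˢ Icc a b
  let S₂ : Set (Y × ℝ) := C ×ˢ {b}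
  let e : Y × ℝ → M := fun p => if p ∈ S₂ then g p.1 else H (p.2, f p.1)
  have he₁ : ∀ p ∈ S₁, e p = H (p.2, f p.1) := by
    rintro ⟨y, t⟩ ⟨hy, ht⟩
    by_cases h : (y, t) ∈ S₂
    · have : t = b := h.2
      subst this
      exact (if_pos h).trans (hgA y hy)
    · exact if_neg h
  have he₂ : ∀ p ∈ S₂, e p = g p.1 := fun p hp => if_pos hp
  have hc₁ : ContinuousOn e S₁ := by
    refine ContinuousOn.congr ?_ he₁
    exact hH.comp_continuousOn (continuousOn_snd.prodMk
      (hf.comp continuousOn_fst fun p hp => hp.1))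
  have hc₂ : ContinuousOn e S₂ :=
    (hg.comp continuousOn_fst fun p hp => hp.1).congr he₂
  have hcl₁ : IsClosed S₁ := hA.prod isClosed_Icc
  have hcl₂ : IsClosed S₂ := hC.prod isClosed_singleton
  have hmaps : MapsTo e (S₁ ∪ S₂) Z' := by
    rintro p (hp | hp)
    · rw [he₁ p hp]
      exact hHZ _ hp.2 _
    · rw [he₂ p hp]
      exact hZZ' (hgZ hp.1)
  obtain ⟨U, hU, hSU, F, hF, hFZ, hFe⟩ := hZ' (Y × ℝ) (S₁ ∪ S₂) e (hcl₁.union hcl₂)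
    (hc₁.union_of_isClosed hc₂ hcl₁ hcl₂) hmaps
  -- The open set where the extension is still `δ`-close to the homotopy of a `δ`-close point of
  -- `A`; the tube lemma finds whole slabs inside it.
  let W : Set (Y × ℝ) := ⋃ x ∈ A, (U ∩ (fun p => dist (F p) (H (p.2, f x)) - δ) ⁻¹' Iio 0) ∩
    {p | dist p.1 x < δ}
  have hW : IsOpen W := by
    refine isOpen_biUnion fun x _ => IsOpen.inter ?_ ?_
    · refine ContinuousOn.isOpen_inter_preimage ?_ hU isOpen_Iio
      have h1 : ContinuousOn (fun p : Y × ℝ => H (p.2, f x)) U := by fun_prop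
      exact (continuous_dist.comp_continuousOn (hF.prodMk h1)).sub continuousOn_const
    · exact isOpen_lt (by fun_prop) continuous_const
  have hWmem : ∀ y t, (y, t) ∈ W →
      (y, t) ∈ U ∧ ∃ x ∈ A, dist y x < δ ∧ dist (F (y, t)) (H (t, f x)) < δ := by
    intro y t h
    simp only [W, mem_iUnion] at h
    obtain ⟨x, hx, ⟨h1, h2⟩, h3⟩ := h
    exact ⟨h1, x, hx, h3, sub_neg.1 h2⟩
  have hFA : ∀ y ∈ A, ∀ t ∈ Icc a b, F (y, t) = H (t, f y) := fun y hy t ht => by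
    have hm : (y, t) ∈ S₁ := ⟨hy, ht⟩
    rw [hFe (Or.inl hm), he₁ _ hm]
  have hAW : A ⊆ {y | ∀ t ∈ Icc a b, (y, t) ∈ W} := by
    intro y hy t ht
    refine mem_biUnion hy ⟨⟨hSU (Or.inl ⟨hy, ht⟩), ?_⟩, ?_⟩
    · rw [mem_preimage, mem_Iio, hFA y hy t ht, dist_self]
      linarith
    · simpa using hδ
  obtain ⟨C', hC', hAC', hC'V⟩ := exists_isClosed_nhdSet hA
    ((isOpen_forall_mem_compact isCompact_Icc hW).inter isOpen_interior)
    (subset_inter hAW hAC)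
  have hC'U : C' ×ˢ Icc a b ⊆ U := by
    rintro ⟨y, t⟩ ⟨hy, ht⟩
    exact (hWmem y t ((hC'V hy).1 t ht)).1
  refine ⟨C', F, hC', hAC', fun y hy => interior_subset (hC'V hy).2, hF.mono hC'U,
    hFZ.mono_left hC'U, fun y hy => ?_, hFA, fun y hy t ht => (hWmem y t ((hC'V hy).1 t ht)).2⟩
  have hm : (y, b) ∈ S₂ := ⟨interior_subset (hC'V hy).2, rfl⟩
  rw [hFe (Or.inr hm), he₂ _ hm]

/-- A metric space which admits small deformations into an increasing sequence of absolute
neighbourhood extensors is an absolute neighbourhood extensor. -/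
theorem isANE_univ_of_deformations {M : Type*} [MetricSpace M] {H : ℝ × M → M}
    (hH : Continuous H) (hH0 : ∀ x, H (0, x) = x) {Z : ℕ → Set M} (hZ : ∀ k, IsANE.{u} (Z k))
    (hmono : Monotone Z) (hHZ : ∀ k, ∀ t ∈ Icc ((1 / 2 : ℝ) ^ k) 1, ∀ x, H (t, x) ∈ Z k) :
    IsANE.{u} (univ : Set M) := by
  classical
  intro Y _ _ A f hA hf _
  let _ : MetricSpace Y := TopologicalSpace.metrizableSpaceMetric Y
  let ε : ℕ → ℝ := fun k => (1 / 2) ^ k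
  have hε0 : ∀ k, 0 < ε k := fun k => by positivity
  have hεs : ∀ k, ε k = 2 * ε (k + 1) := fun k => by simp only [ε, pow_succ]; ring
  have hεanti : StrictAnti ε := pow_right_strictAnti₀ (by norm_num) (by norm_num)
  have hε1 : ∀ k, ε k ≤ 1 := fun k => pow_le_one₀ (by norm_num) (by norm_num)
  -- `P` describes the map available at time `ε k` on a closed neighbourhood of `A`; `R` describes
  -- the slab over `[ε (k + 1), ε k]` linking two stages. The final map restricts these slabs to the
  -- graph of a function `τ` that vanishes exactly on `A`.
  let P : ℕ → Set Y × (Y → M) → Prop := fun k p =>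
    IsClosed p.1 ∧ A ⊆ interior p.1 ∧ ContinuousOn p.2 p.1 ∧ MapsTo p.2 p.1 (Z k) ∧
      ∀ y ∈ A, p.2 y = H (ε k, f y)
  let R : ℕ → Set Y × (Y → M) → Set Y × (Y → M) → (Y × ℝ → M) → Prop := fun k p p' F =>
    p'.1 ⊆ p.1 ∧ ContinuousOn F (p'.1 ×ˢ Icc (ε (k + 1)) (ε k)) ∧
      (∀ y ∈ p'.1, F (y, ε k) = p.2 y) ∧ (∀ y, F (y, ε (k + 1)) = p'.2 y) ∧
      ∀ y ∈ p'.1, ∀ t ∈ Icc (ε (k + 1)) (ε k),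
        ∃ x ∈ A, dist y x < ε k ∧ dist (F (y, t)) (H (t, f x)) < ε k
  have hstart : ∃ p, P 0 p := by
    obtain ⟨U, hU, hAU, F, hF, hFZ, hFA⟩ := hZ 0 Y A (fun y => H (ε 0, f y)) hA
      (hH.comp_continuousOn (continuousOn_const.prodMk hf))
      (fun y _ => hHZ 0 _ ⟨le_rfl, hε1 0⟩ _)
    obtain ⟨C, hC, hAC, hCU⟩ := exists_isClosed_nhdSet hA hU hAU
    exact ⟨(C, F), hC, hAC, hF.mono hCU, hFZ.mono_left hCU, fun y hy => hFA hy⟩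
  have hstep : ∀ k p, P k p → ∃ p', P (k + 1) p' ∧ ∃ F, R k p p' F := by
    rintro k ⟨C, g⟩ ⟨hC, hAC, hg, hgZ, hgA⟩
    have hle : ε (k + 1) ≤ ε k := (hεanti k.lt_succ_self).le
    obtain ⟨C', F, h1, h2, h3, h4, h5, h6, h7, h8⟩ := (hZ (k + 1)).exists_slab hH
      (hmono k.le_succ) hA hf hle (hε0 k) (fun t ht x => hHZ (k + 1) t ⟨ht.1, ht.2.trans (hε1 k)⟩ x)
      hC hAC hg hgZ hgA
    have hl : ε (k + 1) ∈ Icc (ε (k + 1)) (ε k) := ⟨le_rfl, hle⟩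
    exact ⟨(C', fun y => F (y, ε (k + 1))), ⟨h1, h2,
      h4.comp (continuousOn_id.prodMk continuousOn_const) fun y hy => ⟨hy, hl⟩,
      fun y hy => h5 ⟨hy, hl⟩, fun y hy => h7 y hy _ hl⟩, F, h3, h4, h6, fun _ => rfl, h8⟩
  choose! nxt hnxt F' hF' using hstep
  obtain ⟨p₀, hp₀⟩ := hstart
  let p : ℕ → Set Y × (Y → M) := fun k => Nat.rec p₀ (fun k q => nxt k q) k
  have hp : ∀ k, P k (p k) := fun k => by
    induction k with
    | zero => exact hp₀
    | succ k ih => exact hnxt k _ ih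
  let F : ℕ → Y × ℝ → M := fun k => F' k (p k) (hp k)
  have hR : ∀ k, R k (p k) (p (k + 1)) (F k) := fun k => hF' k _ (hp k)
  have hanti : Antitone fun k => (p k).1 := antitone_nat_of_succ_le fun k => (hR k).1
  have hury : ∀ k, ∃ v : Y → ℝ, Continuous v ∧ (∀ y ∈ A, v y = 0) ∧ (∀ y ∉ (p k).1, v y = 1) ∧
      ∀ y, v y ∈ Icc (0 : ℝ) 1 := fun k => by
    obtain ⟨v, h0, h1, h2⟩ := exists_continuous_zero_one_of_isClosed hA
      (isOpen_interior (s := (p k).1)).isClosed_compl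
      (disjoint_compl_right_iff_subset.2 (hp k).2.1)
    exact ⟨v, v.continuous, fun y hy => h0 hy, fun y hy => h1 fun h => hy (interior_subset h), h2⟩
  choose v hv hv0 hv1 hv01 using hury
  have hsum : Summable ε := summable_geometric_of_lt_one (by norm_num) (by norm_num)
  have hbd : ∀ k y, ε k * v k y ≤ ε k := fun k y =>
    mul_le_of_le_one_right (hε0 k).le (hv01 k y).2
  have hnn : ∀ k y, 0 ≤ ε k * v k y := fun k y => mul_nonneg (hε0 k).le (hv01 k y).1
  have hsy : ∀ y, Summable fun k => ε k * v k y := fun y =>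
    hsum.of_nonneg_of_le (fun k => hnn k y) fun k => hbd k y
  -- `τ` must be so large off the shrinking neighbourhoods that a point with `τ y ≤ ε k` still lies
  -- in the domain of the slab `k`.
  let τ : Y → ℝ := fun y => 2 * ∑' k, ε k * v k y
  have hτ : Continuous τ := by
    refine continuous_const.mul (continuous_tsum (u := ε) (fun k => continuous_const.mul (hv k))
      hsum fun k y => ?_)
    rw [Real.norm_of_nonneg (hnn k y)]
    exact hbd k y
  have hτA : ∀ y ∈ A, τ y = 0 := fun y hy => by simp [τ, hv0 _ y hy]
  have hτmem : ∀ k y, τ y ≤ ε k → y ∈ (p (k + 1)).1 := by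
    intro k y hy
    by_contra hmem
    -- The term `k + 1` alone gives only `τ y ≥ 2 * ε (k + 1) = ε k`; the term `k + 2` makes the
    -- inequality strict.
    have h2 : y ∉ (p (k + 2)).1 := fun h => hmem (hanti (Nat.le_succ _) h)
    have := (hsy y).sum_le_tsum {k + 1, k + 2} fun j _ => hnn j y
    rw [Finset.sum_pair (by omega), hv1 _ y hmem, hv1 _ y h2] at this
    have e1 := hεs k
    have e2 := hε0 (k + 2)
    have : 2 * (ε (k + 1) * 1 + ε (k + 2) * 1) ≤ ε k :=
      (mul_le_mul_of_nonneg_left this zero_le_two).trans hy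
    linarith
  have hεlim : Tendsto ε atTop (𝓝 0) :=
    tendsto_pow_atTop_nhds_zero_of_lt_one (by norm_num) (by norm_num)
  have hτpos : ∀ y ∉ A, 0 < τ y := by
    intro y hy
    by_contra! h
    refine hy (hA.closure_subset ?_)
    rw [Metric.mem_closure_iff]
    intro δ hδ
    obtain ⟨k, hk⟩ := (hεlim.eventually (gt_mem_nhds hδ)).exists
    obtain ⟨x, hx, hxy, -⟩ := (hR k).2.2.2.2 y (hτmem k y (h.trans (hε0 k).le)) (ε k)
      ⟨(hεanti k.lt_succ_self).le, le_rfl⟩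
    exact ⟨x, hx, hxy.trans hk⟩
  have hex : ∀ y, y ∉ A → τ y < 1 → ∃ k, ε (k + 1) ≤ τ y ∧ τ y < ε k := by
    intro y hy h1
    have hne : ∃ k, ε k ≤ τ y :=
      ((hεlim.eventually (gt_mem_nhds (hτpos y hy))).exists).imp fun _ h => h.le
    have hpos : Nat.find hne ≠ 0 := fun h => by
      have := Nat.find_spec hne
      rw [h] at this
      simp only [ε, pow_zero] at this
      linarith
    obtain ⟨k, hk⟩ := Nat.exists_eq_succ_of_ne_zero hpos
    refine ⟨k, ?_, ?_⟩
    · have := Nat.find_spec hne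
      rwa [hk] at this
    · have := Nat.find_min hne (m := k) (by omega)
      exact not_le.1 this
  choose! κ hκ1 hκ2 using hex
  -- `κ y` is the index of the slab whose time interval, open at the upper end, contains `τ y`.
  let G : Y → M := fun y => if y ∈ A then f y else F (κ y) (y, τ y)
  have hGA : ∀ y ∈ A, G y = f y := fun y hy => if_pos hy
  have hG : ∀ k, ∀ y ∉ A, τ y < 1 → ε (k + 1) ≤ τ y → τ y ≤ ε k → G y = F k (y, τ y) := by
    intro k y hy h1 hk1 hk2
    have a1 := hκ1 y hy h1
    have a2 := hκ2 y hy h1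
    have hG' : G y = F (κ y) (y, τ y) := if_neg hy
    rw [hG']
    have hle : κ y ≤ k := by
      by_contra! h
      have : ε (κ y) ≤ ε (k + 1) := hεanti.antitone h
      linarith
    rcases hle.eq_or_lt with h | h
    · rw [h]
    -- A different slab can only be the next one, met at the common time `τ y = ε k`, where the two
    -- agree.
    · have b1 : ε k ≤ ε (κ y + 1) := hεanti.antitone h
      have b2 : ε k = ε (κ y + 1) := le_antisymm b1 (a1.trans hk2)
      have b3 : k = κ y + 1 := hεanti.injective b2
      have b4 : τ y = ε k := le_antisymm hk2 (b2 ▸ a1)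
      have b5 : y ∈ (p (k + 1)).1 := hτmem k y hk2
      rw [b4, (hR k).2.2.1 y b5]
      subst b3
      exact (hR (κ y)).2.2.2.1 y
  refine ⟨{y | τ y < 1}, isOpen_lt hτ continuous_const, fun y hy => by simp [hτA y hy], G, ?_,
    fun _ _ => mem_univ _, hGA⟩
  intro y hy1
  have hy1 : τ y < 1 := hy1
  by_cases hy : y ∈ A
  · have hsplit : {y | τ y < 1} ⊆ A ∪ ({y | τ y < 1} \ A) := fun z hz => by
      by_cases hzA : z ∈ A
      · exact Or.inl hzA
      · exact Or.inr ⟨hz, hzA⟩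
    refine ContinuousWithinAt.mono (ContinuousWithinAt.union ?_ ?_) hsplit
    · exact (hf y hy).congr hGA (hGA y hy)
    -- Slab `k` has error below `ε k = 2 * ε (k + 1) ≤ 2 * τ z`, so near `A` the map follows the
    -- homotopy of `f` at times tending to 0.
    · have hclose : ∀ z, ∃ x, z ∈ {y | τ y < 1} \ A →
          x ∈ A ∧ dist z x < 2 * τ z ∧ dist (G z) (H (τ z, f x)) < 2 * τ z := by
        intro z
        by_cases hz : z ∈ {y | τ y < 1} \ A
        · have a1 := hκ1 z hz.2 hz.1
          have a2 := hκ2 z hz.2 hz.1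
          obtain ⟨x, hx, h1, h2⟩ := (hR (κ z)).2.2.2.2 z (hτmem _ z a2.le) (τ z) ⟨a1, a2.le⟩
          rw [← hG _ z hz.2 hz.1 a1 a2.le] at h2
          have e := hεs (κ z)
          exact ⟨x, fun _ => ⟨hx, by linarith, by linarith⟩⟩
        · exact ⟨z, fun h => absurd h hz⟩
      choose x hx using hclose
      have hτlim : Tendsto τ (𝓝[{y | τ y < 1} \ A] y) (𝓝 0) := by
        have := hτ.continuousWithinAt (s := {y | τ y < 1} \ A) (x := y)
        rwa [ContinuousWithinAt, hτA y hy] at this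
      have h2τ : Tendsto (fun z => 2 * τ z) (𝓝[{y | τ y < 1} \ A] y) (𝓝 0) := by
        simpa using hτlim.const_mul 2
      have hxlim : Tendsto x (𝓝[{y | τ y < 1} \ A] y) (𝓝[A] y) := by
        refine tendsto_nhdsWithin_iff.2
          ⟨?_, eventually_nhdsWithin_of_forall fun z hz => (hx z hz).1⟩
        refine (tendsto_iff_of_dist ?_).1 (tendsto_id.mono_left nhdsWithin_le_nhds)
        refine squeeze_zero' (Eventually.of_forall fun _ => dist_nonneg) ?_ h2τ
        exact eventually_nhdsWithin_of_forall fun z hz => (hx z hz).2.1.le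
      have hHlim : Tendsto (fun z => H (τ z, f (x z))) (𝓝[{y | τ y < 1} \ A] y) (𝓝 (f y)) := by
        have := (hH.tendsto (0, f y)).comp (hτlim.prodMk_nhds ((hf y hy).tendsto.comp hxlim))
        rwa [hH0] at this
      rw [ContinuousWithinAt, hGA y hy]
      refine (tendsto_iff_of_dist ?_).2 hHlim
      refine squeeze_zero' (Eventually.of_forall fun _ => dist_nonneg) ?_ h2τ
      exact eventually_nhdsWithin_of_forall fun z hz => (hx z hz).2.2.le
  · obtain ⟨k, hk1, hk2⟩ : ∃ k, ε (k + 1) ≤ τ y ∧ τ y < ε k := ⟨κ y, hκ1 y hy hy1, hκ2 y hy hy1⟩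
    -- Since `ε (k + 2) < τ y < ε k`, the slabs `k` and `k + 1` together cover a neighbourhood of
    -- `y`.
    let S : ℕ → Set Y := fun j => {z | τ z < 1} ∩ Aᶜ ∩ τ ⁻¹' Icc (ε (j + 1)) (ε j)
    have hS : ∀ j, ContinuousOn G (S j) := by
      intro j
      have h : ContinuousOn (fun z => F j (z, τ z)) (S j) :=
        (hR j).2.1.comp (continuousOn_id.prodMk hτ.continuousOn)
          fun z hz => ⟨hτmem j z hz.2.2, hz.2⟩
      exact h.congr fun z hz => hG j z hz.1.2 hz.1.1 hz.2.1 hz.2.2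
    have hwithin : ContinuousWithinAt G (S k ∪ S (k + 1)) y := by
      refine ContinuousWithinAt.union (hS k y ⟨⟨hy1, hy⟩, hk1, hk2.le⟩) ?_
      by_cases hyS : y ∈ S (k + 1)
      · exact hS _ y hyS
      · refine continuousWithinAt_of_notMem_closure fun h => hyS ⟨⟨hy1, hy⟩, ?_⟩
        exact (isClosed_Icc.preimage hτ).closure_subset_iff.2 inter_subset_right h
    refine (hwithin.continuousAt ?_).continuousWithinAt
    have hk3 : ε (k + 2) < τ y := (hεanti (Nat.lt_succ_self _)).trans_le hk1
    filter_upwards [(isOpen_lt hτ continuous_const).mem_nhds hy1, hA.isOpen_compl.mem_nhds hy,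
      (isOpen_Ioo.preimage hτ).mem_nhds (show τ y ∈ Ioo (ε (k + 2)) (ε k) from ⟨hk3, hk2⟩)]
      with z hz1 hz2 hz3
    rcases le_total (ε (k + 1)) (τ z) with h | h
    · exact Or.inl ⟨⟨hz1, hz2⟩, h, hz3.2.le⟩
    · exact Or.inr ⟨⟨hz1, hz2⟩, hz3.1.le, h⟩

end Telescope

/-! ### Max-plus combinations written with weights in [0, 1] -/

section WeightedCombinations

/-- The functional `φ ↦ max_i (log (s i) + φ (p i))`, with weights `s i ∈ [0, 1]`. -/
noncomputable def weightedComb {X ι : Type*} [TopologicalSpace X] (s : ι → ℝ) (p : ι → X) :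
    C(X, ℝ) → ℝ :=
  fun φ => Real.log (⨆ i, s i * Real.exp (φ (p i)))

theorem bddAbove_weights {X ι : Type*} [TopologicalSpace X] [CompactSpace X] {s : ι → ℝ}
    (p : ι → X) (h1 : ∀ i, s i ≤ 1) (φ : C(X, ℝ)) :
    BddAbove (range fun i => s i * Real.exp (φ (p i))) := by
  refine ⟨Real.exp ‖φ‖, ?_⟩
  rintro _ ⟨i, rfl⟩
  have h2 : φ (p i) ≤ ‖φ‖ := (le_abs_self _).trans (φ.norm_coe_le_norm (p i))
  exact (mul_le_of_le_one_left (Real.exp_pos _).le (h1 i)).trans (Real.exp_le_exp.2 h2)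

theorem iSup_weights_pos {X ι : Type*} [TopologicalSpace X] [CompactSpace X] {s : ι → ℝ}
    (p : ι → X) (h1 : ∀ i, s i ≤ 1) {b : ι} (hb : 0 < s b) (φ : C(X, ℝ)) :
    0 < ⨆ i, s i * Real.exp (φ (p i)) :=
  (mul_pos hb (Real.exp_pos _)).trans_le (le_ciSup (bddAbove_weights p h1 φ) b)

/-- Repeated points and zero weights are allowed on the weighted side: only the largest weight at
each point matters. -/
theorem weightedComb_eq_maxPlusComb {X : Type u} {ι : Type*} [TopologicalSpace X]
    {S : Finset X} {hS : S.Nonempty} {c : X → ℝ} {s : ι → ℝ} {p : ι → X} (h0 : ∀ i, 0 ≤ s i)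
    (h1 : ∀ i, 0 < s i → p i ∈ S ∧ s i ≤ Real.exp (c (p i)))
    (h2 : ∀ x ∈ S, ∃ i, p i = x ∧ Real.exp (c x) ≤ s i) :
    weightedComb s p = maxPlusComb S hS c := by
  funext φ
  have hle : ∀ i, s i * Real.exp (φ (p i)) ≤ Real.exp (maxPlusComb S hS c φ) := by
    intro i
    rcases (h0 i).eq_or_lt with h | h
    · rw [← h, zero_mul]
      exact (Real.exp_pos _).le
    · obtain ⟨hp, hsi⟩ := h1 i h
      calc s i * Real.exp (φ (p i)) ≤ Real.exp (c (p i)) * Real.exp (φ (p i)) := by gcongr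
        _ = Real.exp (c (p i) + φ (p i)) := (Real.exp_add _ _).symm
        _ ≤ _ := Real.exp_le_exp.2 (Finset.le_sup' (fun x => c x + φ x) hp)
  have hge : Real.exp (maxPlusComb S hS c φ) ≤ ⨆ i, s i * Real.exp (φ (p i)) := by
    obtain ⟨x, hx, hxm⟩ := Finset.exists_mem_eq_sup' hS (fun x => c x + φ x)
    obtain ⟨i, rfl, hi⟩ := h2 x hx
    have : maxPlusComb S hS c φ = c (p i) + φ (p i) := hxm
    rw [this, Real.exp_add]
    refine le_trans ?_ (le_ciSup ⟨Real.exp (maxPlusComb S hS c φ), ?_⟩ i)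
    · gcongr
    · rintro _ ⟨j, rfl⟩
      exact hle j
  have : Nonempty ι := by
    obtain ⟨x, hx⟩ := hS
    exact ⟨(h2 x hx).choose⟩
  have heq : ⨆ i, s i * Real.exp (φ (p i)) = Real.exp (maxPlusComb S hS c φ) :=
    le_antisymm (ciSup_le hle) hge
  rw [weightedComb, heq, Real.log_exp]

theorem iSup_weights_le {X ι κ : Type*} [TopologicalSpace X] [CompactSpace X] {s : ι → ℝ}
    {p : ι → X} {t : κ → ℝ} {r : κ → X} (hs0 : ∀ i, 0 ≤ s i) (ht0 : ∀ i, 0 ≤ t i)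
    (ht1 : ∀ i, t i ≤ 1) (h : ∀ i, 0 < s i → ∃ j, r j = p i ∧ s i ≤ t j) (φ : C(X, ℝ)) :
    ⨆ i, s i * Real.exp (φ (p i)) ≤ ⨆ j, t j * Real.exp (φ (r j)) := by
  have hnn : 0 ≤ ⨆ j, t j * Real.exp (φ (r j)) :=
    Real.iSup_nonneg fun j => mul_nonneg (ht0 j) (Real.exp_pos _).le
  refine Real.iSup_le (fun i => ?_) hnn
  rcases (hs0 i).eq_or_lt with h' | h'
  · rw [← h', zero_mul]
    exact hnn
  · obtain ⟨j, hj, hij⟩ := h i h'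
    refine le_trans ?_ (le_ciSup (bddAbove_weights r ht1 φ) j)
    rw [hj]
    gcongr

theorem weightedComb_congr {X ι κ : Type*} [TopologicalSpace X] [CompactSpace X] {s : ι → ℝ}
    {p : ι → X} {t : κ → ℝ} {r : κ → X} (hs0 : ∀ i, 0 ≤ s i) (hs1 : ∀ i, s i ≤ 1)
    (ht0 : ∀ i, 0 ≤ t i) (ht1 : ∀ i, t i ≤ 1)
    (hst : ∀ i, 0 < s i → ∃ j, r j = p i ∧ s i ≤ t j)
    (hts : ∀ j, 0 < t j → ∃ i, p i = r j ∧ t j ≤ s i) : weightedComb s p = weightedComb t r :=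
  funext fun φ => congrArg Real.log
    (le_antisymm (iSup_weights_le hs0 ht0 ht1 hst φ) (iSup_weights_le ht0 hs0 hs1 hts φ))

/-- The weights and points of a combination are determined by the functional. -/
theorem exists_ge_of_weightedComb_eq {X ι κ : Type*} [TopologicalSpace X] [CompactSpace X]
    [T2Space X] {s : ι → ℝ} {p : ι → X} {t : κ → ℝ} {r : κ → X}
    (hs1 : ∀ i, s i ≤ 1) (ht0 : ∀ i, 0 ≤ t i) (ht1 : ∀ i, t i ≤ 1)
    (htf : (Function.support t).Finite) (htb : ∃ b, 0 < t b)
    (h : weightedComb s p = weightedComb t r) {i : ι} (hi : 0 < s i) :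
    ∃ j, r j = p i ∧ s i ≤ t j := by
  by_contra! hcon
  have hF : ((r '' Function.support t) \ {p i}).Finite := (htf.image r).sdiff
  obtain ⟨g, hg0, hg1, -⟩ := exists_continuous_zero_one_of_isClosed
    (isClosed_singleton (x := p i)) hF.isClosed disjoint_sdiff_right
  have hg0 : g (p i) = 0 := hg0 rfl
  -- This test function is 0 at `p i` and `log (s i) - 1` at the other points of the right side,
  -- whose contributions are then at most `s i / e`.
  let φ : C(X, ℝ) := -(1 - Real.log (s i)) • g
  have hφi : φ (p i) = 0 := by simp [φ, hg0]
  have hlt : ∀ j, 0 < t j → t j * Real.exp (φ (r j)) < s i := by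
    intro j hj
    by_cases hji : r j = p i
    · rw [hji, hφi, Real.exp_zero, mul_one]
      exact hcon j hji
    · have : g (r j) = 1 := hg1 ⟨⟨j, hj.ne', rfl⟩, hji⟩
      have hφ : φ (r j) = Real.log (s i) - 1 := by
        simp [φ, this]
      calc t j * Real.exp (φ (r j)) ≤ Real.exp (φ (r j)) :=
            mul_le_of_le_one_left (Real.exp_pos _).le (ht1 j)
        _ < Real.exp (Real.log (s i)) := Real.exp_lt_exp.2 (by rw [hφ]; linarith)
        _ = s i := Real.exp_log hi
  obtain ⟨b, hb⟩ := htb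
  have hne : htf.toFinset.Nonempty := ⟨b, by simpa using hb.ne'⟩
  let m := htf.toFinset.sup' hne fun j => t j * Real.exp (φ (r j))
  have hm : m < s i := by
    refine (Finset.sup'_lt_iff hne).2 fun j hj => hlt j ?_
    exact (ht0 j).lt_of_ne' (by simpa using hj)
  have hm0 : 0 < m := (mul_pos hb (Real.exp_pos _)).trans_le
    (Finset.le_sup' (fun j => t j * Real.exp (φ (r j))) (by simpa using hb.ne'))
  have hsup : ⨆ j, t j * Real.exp (φ (r j)) ≤ m := by
    refine Real.iSup_le (fun j => ?_) hm0.le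
    by_cases hj : t j = 0
    · rw [hj, zero_mul]
      exact hm0.le
    · exact Finset.le_sup' (fun j => t j * Real.exp (φ (r j))) (by simpa using hj)
  have h1 : s i ≤ ⨆ i, s i * Real.exp (φ (p i)) := by
    have := le_ciSup (bddAbove_weights p hs1 φ) i
    rwa [hφi, Real.exp_zero, mul_one] at this
  have h2 : weightedComb t r φ < weightedComb s p φ :=
    Real.log_lt_log (iSup_weights_pos r ht1 hb φ) ((hsup.trans_lt hm).trans_le h1)
  rw [h] at h2
  exact lt_irrefl _ h2

/-- Finitely many nonnegative weights, one of which is `1` while the others are at most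
`1 / (n + 1)`, where `n` is the number of nonzero weights. -/
structure IsGapWeight {ι : Type*} (s : ι → ℝ) (b : ι) : Prop where
  nonneg : ∀ i, 0 ≤ s i
  base : s b = 1
  finite : (Function.support s).Finite
  gap : ∀ i, i ≠ b → s i * ((Function.support s).ncard + 1) ≤ 1

theorem IsGapWeight.lt_one {ι : Type*} {s : ι → ℝ} {b : ι} (h : IsGapWeight s b) {i : ι}
    (hi : i ≠ b) : s i < 1 := by
  have h1 := h.gap i hi
  have h2 : 0 < (Function.support s).ncard :=
    (Set.ncard_pos h.finite).2 ⟨b, by simp [h.base]⟩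
  have h3 : (0 : ℝ) < (Function.support s).ncard := by exact_mod_cast h2
  nlinarith [h.nonneg i]

theorem IsGapWeight.le_one {ι : Type*} {s : ι → ℝ} {b : ι} (h : IsGapWeight s b) (i : ι) :
    s i ≤ 1 := by
  by_cases hi : i = b
  · rw [hi, h.base]
  · exact (h.lt_one hi).le

/-- The conditions on the support, the masses and the base point of an element of `I_f(X)`. -/
structure IsGapMass {X : Type*} (S : Finset X) (c : X → ℝ) (x₀ : X) : Prop where
  mem : x₀ ∈ S
  base : c x₀ = 0
  gap : ∀ x ∈ S, x ≠ x₀ → c x ≤ -Real.log ((S.card : ℝ) + 1)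

theorem IsGapMass.mem_idemMeasuresF {X : Type u} [TopologicalSpace X] [CompactSpace X] [T2Space X]
    {S : Finset X} {c : X → ℝ} {x₀ : X} (h : IsGapMass S c x₀) (hS : S.Nonempty) :
    maxPlusComb S hS c ∈ IdemMeasuresF X :=
  mem_idemMeasuresF_iff.2 ⟨S, hS, c, rfl, x₀, h.mem, h.base, h.gap⟩

/-- Merging the indices that carry the same point keeps the largest weight and can only lower the
number of points, so the gap condition survives. -/
theorem IsGapWeight.exists_isGapMass {X : Type u} {ι : Type*} [TopologicalSpace X] {s : ι → ℝ}
    {b : ι} (h : IsGapWeight s b) (p : ι → X) :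
    ∃ (S : Finset X) (hS : S.Nonempty) (c : X → ℝ), IsGapMass S c (p b) ∧
      weightedComb s p = maxPlusComb S hS c ∧ (S : Set X) = p '' Function.support s := by
  classical
  let S : Finset X := h.finite.toFinset.image p
  have hSmem : ∀ x, x ∈ S ↔ ∃ i, s i ≠ 0 ∧ p i = x := fun x => by simp [S]
  have hpb : p b ∈ S := (hSmem _).2 ⟨b, by simp [h.base], rfl⟩
  have key : ∀ x : X, ∃ i : ι, x ∈ S → s i ≠ 0 ∧ p i = x ∧ ∀ j, p j = x → s j ≤ s i := by
    intro x
    by_cases hx : x ∈ S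
    · have hne : (h.finite.toFinset.filter fun i => p i = x).Nonempty := by
        obtain ⟨i, hi, hix⟩ := (hSmem x).1 hx
        exact ⟨i, by simp [hi, hix]⟩
      obtain ⟨i, hi, hmax⟩ := Finset.exists_max_image _ s hne
      simp only [Finset.mem_filter, Finite.mem_toFinset, Function.mem_support] at hi hmax
      refine ⟨i, fun _ => ⟨hi.1, hi.2, fun j hj => ?_⟩⟩
      by_cases h0 : s j = 0
      · rw [h0]
        exact h.nonneg i
      · exact hmax j ⟨h0, hj⟩
    · exact ⟨b, fun h => absurd h hx⟩
  choose g hg using key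
  have hpos : ∀ x ∈ S, 0 < s (g x) := fun x hx => (h.nonneg _).lt_of_ne' (hg x hx).1
  have hcard : S.card ≤ (Function.support s).ncard := by
    rw [Set.ncard_eq_toFinset_card _ h.finite]
    exact Finset.card_image_le
  refine ⟨S, ⟨_, hpb⟩, fun x => Real.log (s (g x)), ⟨hpb, ?_, ?_⟩, ?_, ?_⟩
  · have h1 := (hg _ hpb).2.2 b rfl
    rw [h.base] at h1
    rw [le_antisymm (h.le_one _) h1, Real.log_one]
  · intro x hx hxb
    have hgb : g x ≠ b := fun e => hxb (by rw [← e, (hg x hx).2.1])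
    rw [← Real.log_inv]
    refine Real.log_le_log (hpos x hx) ?_
    rw [← one_div, le_div_iff₀ (by positivity)]
    refine le_trans ?_ (h.gap _ hgb)
    have : (S.card : ℝ) ≤ (Function.support s).ncard := by exact_mod_cast hcard
    exact mul_le_mul_of_nonneg_left (by linarith) (h.nonneg _)
  · refine weightedComb_eq_maxPlusComb h.nonneg (fun i hi => ?_) fun x hx => ?_
    · have hx : p i ∈ S := (hSmem _).2 ⟨i, hi.ne', rfl⟩
      exact ⟨hx, by
        rw [Real.exp_log (hpos _ hx)]
        exact (hg _ hx).2.2 i rfl⟩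
    · exact ⟨g x, (hg x hx).2.1, by rw [Real.exp_log (hpos _ hx)]⟩
  · ext x
    simp [hSmem]

theorem IsGapWeight.weightedComb_mem {X : Type u} {ι : Type*} [TopologicalSpace X]
    [CompactSpace X] [T2Space X] {s : ι → ℝ} {b : ι} (h : IsGapWeight s b) (p : ι → X) :
    weightedComb s p ∈ IdemMeasuresF X := by
  obtain ⟨S, hS, c, hc, heq, -⟩ := h.exists_isGapMass p
  rw [heq]
  exact hc.mem_idemMeasuresF hS

end WeightedCombinations

/-! ### A compact space of weight sequences -/

section SequenceModel

/-- Sequences of weights with `s 0 = 1` such that, if the weight `i ≥ 1` does not vanish, then all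
weights of positive index are at most `1 / (i + 2)`. -/
def seqWeights : Set (ℕ → ℝ) :=
  {s | s 0 = 1 ∧ (∀ i, 0 ≤ s i) ∧ ∀ i j, 1 ≤ i → 1 ≤ j → s i = 0 ∨ s j ≤ 1 / ((i : ℝ) + 2)}

theorem seqWeights_le {s : ℕ → ℝ} (hs : s ∈ seqWeights) {i : ℕ} (hi : 1 ≤ i) :
    s i ≤ 1 / ((i : ℝ) + 2) := by
  rcases hs.2.2 i i hi hi with h | h
  · rw [h]
    positivity
  · exact h

theorem seqWeights_lt_one {s : ℕ → ℝ} (hs : s ∈ seqWeights) {i : ℕ} (hi : 1 ≤ i) : s i < 1 := by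
  refine (seqWeights_le hs hi).trans_lt ?_
  rw [div_lt_one (by positivity)]
  have : (0 : ℝ) ≤ i := Nat.cast_nonneg i
  linarith

theorem seqWeights_le_one {s : ℕ → ℝ} (hs : s ∈ seqWeights) (i : ℕ) : s i ≤ 1 := by
  rcases Nat.eq_zero_or_pos i with rfl | h
  · exact hs.1.le
  · exact (seqWeights_lt_one hs h).le

/-- The gap condition is phrased as a disjunction of two closed conditions on pairs of indices,
instead of through the cardinality of the support, so that it passes to limits. -/
theorem isCompact_seqWeights : IsCompact seqWeights := by
  refine (isCompact_univ_pi fun _ : ℕ => isCompact_Icc (a := (0 : ℝ)) (b := 1)).of_isClosed_subset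
    ?_ fun s hs i _ => ⟨hs.2.1 i, seqWeights_le_one hs i⟩
  have : seqWeights = {s | s 0 = 1} ∩ ({s | ∀ i, 0 ≤ s i} ∩
      ⋂ (i : ℕ) (j : ℕ) (_ : 1 ≤ i) (_ : 1 ≤ j), {s | s i = 0} ∪ {s | s j ≤ 1 / ((i : ℝ) + 2)}) := by
    ext s
    simp [seqWeights]
  rw [this]
  refine (isClosed_eq (by fun_prop) continuous_const).inter (IsClosed.inter ?_ ?_)
  · rw [ofPred_forall]
    exact isClosed_iInter fun i => isClosed_le continuous_const (continuous_apply i)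
  · exact isClosed_iInter fun i => isClosed_iInter fun j => isClosed_iInter fun _ =>
      isClosed_iInter fun _ => (isClosed_eq (continuous_apply i) continuous_const).union
        (isClosed_le (continuous_apply j) continuous_const)

instance : CompactSpace seqWeights := isCompact_iff_compactSpace.1 isCompact_seqWeights

/-- A positive weight `s j` with `j ≥ 1` bounds every index `i` of the support by `i + 2 ≤ 1 / s j`.
If `m` is the largest such index, the support has at most `m + 1` elements, and the other weights
are at most `1 / (m + 2)`. -/
theorem isGapWeight_of_mem_seqWeights {s : ℕ → ℝ} (hs : s ∈ seqWeights) : IsGapWeight s 0 := by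
  have key : ∀ j, 1 ≤ j → s j ≠ 0 →
      ∃ n : ℕ, Function.support s ⊆ Iio n ∧ ∀ i, 1 ≤ i → s i * ((n : ℝ) + 1) ≤ 1 := by
    intro j hj hsj
    have hjp : 0 < s j := (hs.2.1 j).lt_of_ne' hsj
    have hfin : (Function.support s).Finite := by
      obtain ⟨n, hn⟩ := exists_nat_gt (1 / s j)
      refine (Set.finite_Iio (n + 1)).subset fun i hi => ?_
      rcases Nat.eq_zero_or_pos i with rfl | hi1
      · exact Nat.succ_pos n
      · have h1 := (hs.2.2 i j hi1 hj).resolve_left hi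
        rw [le_div_iff₀ (by positivity)] at h1
        rw [div_lt_iff₀ hjp] at hn
        have h2 : (i : ℝ) < n := by nlinarith
        have : i < n := by exact_mod_cast h2
        exact Set.mem_Iio.2 (by omega)
    obtain ⟨m, hm, hmax⟩ := Finset.exists_max_image (hfin.toFinset) id ⟨j, by simpa using hsj⟩
    simp only [Finite.mem_toFinset, Function.mem_support, id] at hm hmax
    have hjm : j ≤ m := hmax j hsj
    refine ⟨m + 1, fun i hi => Set.mem_Iio.2 (Nat.lt_succ_of_le (hmax i hi)), fun i hi => ?_⟩
    have h1 := (hs.2.2 m i (hj.trans hjm) hi).resolve_left hm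
    rw [le_div_iff₀ (by positivity)] at h1
    push_cast
    linarith
  by_cases h : ∃ j, 1 ≤ j ∧ s j ≠ 0
  · obtain ⟨j, hj, hsj⟩ := h
    obtain ⟨n, hn, hgap⟩ := key j hj hsj
    refine ⟨hs.2.1, hs.1, (Set.finite_Iio n).subset hn, fun i hi => ?_⟩
    have h1 := Set.ncard_le_ncard hn (Set.finite_Iio n)
    have h2 : (Set.Iio n).ncard = n := by
      rw [← Finset.coe_Iio, Set.ncard_coe_finset, Nat.card_Iio]
    rw [h2] at h1
    have h3 : ((Function.support s).ncard : ℝ) ≤ n := by exact_mod_cast h1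
    refine le_trans ?_ (hgap i (Nat.one_le_iff_ne_zero.2 hi))
    exact mul_le_mul_of_nonneg_left (by linarith) (hs.2.1 i)
  · push Not at h
    refine ⟨hs.2.1, hs.1, (Set.finite_singleton 0).subset fun i hi => ?_, fun i hi => ?_⟩
    · by_contra h0
      exact hi (h i (Nat.one_le_iff_ne_zero.2 h0))
    · rw [h i (Nat.one_le_iff_ne_zero.2 hi), zero_mul]
      exact zero_le_one

/-- The support is listed with the base point at index 0 and padded with zero weights; for an index
`1 ≤ i < n` of a support with `n` points, `1 / (n + 1) ≤ 1 / (i + 2)`. -/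
theorem exists_seqWeights {X : Type u} [TopologicalSpace X] [CompactSpace X] [T2Space X]
    {μ : C(X, ℝ) → ℝ} (hμ : μ ∈ IdemMeasuresF X) :
    ∃ s ∈ seqWeights, ∃ p : ℕ → X, weightedComb s p = μ := by
  classical
  obtain ⟨S, hS, c, rfl, x₀, h1, h2, h3⟩ := mem_idemMeasuresF_iff.1 hμ
  let L : List X := x₀ :: (S.erase x₀).toList
  have hLmem : ∀ x, x ∈ L ↔ x ∈ S := by
    intro x
    by_cases hx : x = x₀ <;> simp [L, hx, h1]
  have hLlen : L.length = S.card := by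
    have := Finset.card_pos.2 hS
    simp [L, Finset.card_erase_of_mem h1]
    omega
  have hLnd : L.Nodup := by
    simp [L, Finset.nodup_toList]
  let p : ℕ → X := fun i => L.getD i x₀
  have hp : ∀ i (hi : i < L.length), p i = L[i] := fun i hi => List.getD_eq_getElem _ _ hi
  have hp0 : p 0 = x₀ := rfl
  let s : ℕ → ℝ := fun i => if i < L.length then Real.exp (c (p i)) else 0
  have hs : ∀ i, i < L.length → s i = Real.exp (c (p i)) := fun i hi => if_pos hi
  have hs' : ∀ i, ¬ i < L.length → s i = 0 := fun i hi => if_neg hi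
  have hL0 : 0 < L.length := by simp [L]
  have hpS : ∀ i, i < L.length → p i ∈ S := fun i hi => by
    rw [hp i hi, ← hLmem]
    exact List.getElem_mem hi
  have hn : ∀ i, 0 ≤ s i := fun i => by
    by_cases hi : i < L.length
    · rw [hs i hi]
      exact (Real.exp_pos _).le
    · rw [hs' i hi]
  refine ⟨s, ⟨?_, hn, fun i j hi hj => ?_⟩, p, ?_⟩
  · rw [hs 0 hL0, hp0, h2, Real.exp_zero]
  · by_cases hiL : i < L.length
    · right
      by_cases hjL : j < L.length
      · have hne : p j ≠ x₀ := by
          rw [hp j hjL]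
          intro h
          have h0 : L[0] = x₀ := rfl
          have := (hLnd.getElem_inj_iff (hi := hjL) (hj := hL0)).1 (h.trans h0.symm)
          omega
        have := h3 _ (hpS j hjL) hne
        rw [hs j hjL, one_div]
        calc Real.exp (c (p j)) ≤ Real.exp (-Real.log ((S.card : ℝ) + 1)) :=
              Real.exp_le_exp.2 this
          _ = ((S.card : ℝ) + 1)⁻¹ := by rw [Real.exp_neg, Real.exp_log (by positivity)]
          _ ≤ _ := by
            have : i + 1 ≤ S.card := by omega
            have : (i : ℝ) + 1 ≤ S.card := by exact_mod_cast this
            exact inv_anti₀ (by positivity) (by linarith)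
      · rw [hs' j hjL]
        positivity
    · exact Or.inl (hs' i hiL)
  · refine weightedComb_eq_maxPlusComb hn (fun i hi => ?_) fun x hx => ?_
    · have hiL : i < L.length := by
        by_contra h
        rw [hs' i h] at hi
        exact lt_irrefl _ hi
      exact ⟨hpS i hiL, (hs i hiL).le⟩
    · obtain ⟨i, hi, rfl⟩ := List.getElem_of_mem ((hLmem x).2 hx)
      exact ⟨i, hp i hi, by rw [hs i hi, hp i hi]⟩

end SequenceModel

/-! ### Compactness, metrizability and the base point of I_f(X) -/

section Continuity

open Filter

/-- The supremum of a sequence of nonnegative functions with uniformly decaying tails is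
continuous. -/
theorem continuousOn_iSup_of_le {Ω : Type*} [TopologicalSpace Ω] {S : Set Ω} {a : ℕ → Ω → ℝ}
    (ha : ∀ i, ContinuousOn (a i) S) (h0 : ∀ i, ∀ ω ∈ S, 0 ≤ a i ω) {C : ℝ}
    (hC : ∀ i, 1 ≤ i → ∀ ω ∈ S, a i ω ≤ C / ((i : ℝ) + 2)) :
    ContinuousOn (fun ω => ⨆ i, a i ω) S := by
  rcases S.eq_empty_or_nonempty with rfl | ⟨ω₀, hω₀⟩
  · exact continuousOn_empty _
  have hC0 : 0 ≤ C := by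
    have := (h0 1 ω₀ hω₀).trans (hC 1 le_rfl ω₀ hω₀)
    by_contra! h
    have : C / ((1 : ℕ) + 2 : ℝ) < 0 := div_neg_of_neg_of_pos h (by positivity)
    linarith
  have hCle : ∀ n i : ℕ, n ≤ i → C / ((i : ℝ) + 2) ≤ C / ((n : ℝ) + 2) := fun n i hni => by
    have : (n : ℝ) ≤ i := by exact_mod_cast hni
    gcongr
  have hbdd : ∀ ω ∈ S, BddAbove (range fun i => a i ω) := fun ω hω => by
    refine ⟨max (a 0 ω) C, ?_⟩
    rintro _ ⟨i, rfl⟩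
    rcases Nat.eq_zero_or_pos i with rfl | hi
    · exact le_max_left _ _
    · refine le_max_of_le_right ((hC i hi ω hω).trans (div_le_self hC0 ?_))
      have : (0 : ℝ) ≤ i := Nat.cast_nonneg i
      linarith
  let P : ℕ → Ω → ℝ := fun n ω => (Finset.range (n + 1)).sup' ⟨0, by simp⟩ fun i => a i ω
  have hP : ∀ n, ContinuousOn (P n) S := fun n =>
    ContinuousOn.finset_sup'_apply _ fun i _ => ha i
  have hPle : ∀ n, ∀ ω ∈ S, P n ω ≤ ⨆ i, a i ω := fun n ω hω =>
    Finset.sup'_le _ _ fun i _ => le_ciSup (hbdd ω hω) i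
  have hPge : ∀ n, ∀ ω ∈ S, ⨆ i, a i ω ≤ P n ω + C / ((n : ℝ) + 2) := fun n ω hω => by
    have hnn : 0 ≤ C / ((n : ℝ) + 2) := div_nonneg hC0 (by positivity)
    have hP0 : 0 ≤ P n ω := (h0 0 ω hω).trans
      (Finset.le_sup' (fun i => a i ω) (Finset.mem_range.2 (Nat.succ_pos n)))
    refine ciSup_le fun i => ?_
    by_cases hi : i < n + 1
    · have : a i ω ≤ P n ω := Finset.le_sup' (fun i => a i ω) (Finset.mem_range.2 hi)
      linarith
    · have := (hC i (by omega) ω hω).trans (hCle n i (by omega))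
      linarith
  have hunif : TendstoUniformlyOn P (fun ω => ⨆ i, a i ω) atTop S := by
    rw [Metric.tendstoUniformlyOn_iff]
    intro ε hε
    have hlim : Tendsto (fun n : ℕ => C / ((n : ℝ) + 2)) atTop (𝓝 0) :=
      tendsto_const_nhds.div_atTop
        (tendsto_atTop_add_const_right _ _ tendsto_natCast_atTop_atTop)
    filter_upwards [hlim.eventually (gt_mem_nhds hε)] with n hn ω hω
    rw [Real.dist_eq, abs_of_nonneg (sub_nonneg.2 (hPle n ω hω))]
    linarith [hPge n ω hω]
  exact hunif.continuousOn (Frequently.of_forall hP)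

/-- The decay of `seqWeights` makes the tails of the supremum uniformly small. Continuity is
required only of weight times exponential, so a point may jump where its weight vanishes. -/
theorem continuousOn_weightedComb {Ω X : Type*} [TopologicalSpace Ω] [TopologicalSpace X]
    [CompactSpace X] {S : Set Ω} {w : Ω → ℕ → ℝ} {p : Ω → ℕ → X} (hw : ∀ ω, w ω ∈ seqWeights)
    (hc : ∀ (ψ : C(X, ℝ)) (i : ℕ), ContinuousOn (fun ω => w ω i * Real.exp (ψ (p ω i))) S) :
    ContinuousOn (fun ω => weightedComb (w ω) (p ω)) S := by
  refine continuousOn_pi.2 fun ψ => ContinuousOn.log ?_ fun ω _ => ?_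
  · refine continuousOn_iSup_of_le (hc ψ)
      (fun i ω _ => mul_nonneg ((hw ω).2.1 i) (Real.exp_pos _).le) (C := Real.exp ‖ψ‖) ?_
    intro i hi ω _
    have h1 : ψ (p ω i) ≤ ‖ψ‖ := (le_abs_self _).trans (ψ.norm_coe_le_norm _)
    have h2 := seqWeights_le (hw ω) hi
    calc w ω i * Real.exp (ψ (p ω i)) ≤ 1 / ((i : ℝ) + 2) * Real.exp ‖ψ‖ := by gcongr
      _ = _ := by ring
  · refine (iSup_weights_pos (p ω) (seqWeights_le_one (hw ω)) (b := 0) ?_ ψ).ne'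
    rw [(hw ω).1]
    exact one_pos

theorem idemMeasuresF_subset (X : Type u) [TopologicalSpace X] :
    IdemMeasuresF X ⊆ IdemMeasures X := by
  rintro μ ⟨⟨n, -, h⟩, -⟩
  exact h.1

/-- Monotonicity and compatibility with constants make `μ` 1-Lipschitz; hence its values on a
countable dense set of functions determine it. -/
theorem idemMeasures_continuous {X : Type u} [TopologicalSpace X] [CompactSpace X]
    {μ : C(X, ℝ) → ℝ} (hμ : μ ∈ IdemMeasures X) : Continuous μ := by
  have hmono : ∀ φ ψ : C(X, ℝ), φ ≤ ψ → μ φ ≤ μ ψ := fun φ ψ h => by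
    have := hμ.2.2 φ ψ
    rw [sup_eq_right.2 h] at this
    exact (le_max_left _ _).trans this.ge
  have hle : ∀ φ ψ : C(X, ℝ), μ φ ≤ μ ψ + dist φ ψ := fun φ ψ => by
    have h := hmono φ (ContinuousMap.const X (dist φ ψ) + ψ) fun x => by
      have h1 := (le_abs_self (φ x - ψ x)).trans (ContinuousMap.dist_apply_le_dist (f := φ) (g := ψ) x)
      change φ x ≤ dist φ ψ + ψ x
      linarith
    rw [hμ.2.1] at h
    linarith
  refine LipschitzWith.continuous (K := 1) (LipschitzWith.of_le_add fun φ ψ => hle φ ψ)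

variable {X : Type u} [TopologicalSpace X] [CompactSpace X] [T2Space X]

/-- The parametrization of `I_f(X)` by sequences of weights and points. -/
noncomputable def seqComb (k : seqWeights × (ℕ → X)) : IdemMeasuresF X :=
  ⟨weightedComb k.1.1 k.2, (isGapWeight_of_mem_seqWeights k.1.2).weightedComb_mem k.2⟩

theorem continuous_seqComb : Continuous (seqComb (X := X)) := by
  refine Continuous.subtype_mk ?_ _
  rw [← continuousOn_univ]
  exact continuousOn_weightedComb (fun k : seqWeights × (ℕ → X) => k.1.2) fun ψ i =>
    Continuous.continuousOn (((continuous_apply i).comp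
      (continuous_subtype_val.comp continuous_fst)).mul (by fun_prop))

theorem surjective_seqComb : Function.Surjective (seqComb (X := X)) := by
  rintro ⟨μ, hμ⟩
  obtain ⟨s, hs, p, h⟩ := exists_seqWeights hμ
  exact ⟨(⟨s, hs⟩, p), Subtype.ext h⟩

instance : CompactSpace (IdemMeasuresF X) :=
  ⟨by
    rw [← surjective_seqComb.range_eq]
    exact isCompact_range continuous_seqComb⟩

/-- A continuous map from a compact space to a Hausdorff space is proper, and properness survives
products. The factor `Λ` serves homotopies. -/
theorem isQuotientMap_prodMap_seqComb (Λ : Type*) [TopologicalSpace Λ] :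
    IsQuotientMap (Prod.map id seqComb : Λ × (seqWeights × (ℕ → X)) → Λ × IdemMeasuresF X) := by
  have h : IsProperMap (seqComb (X := X)) := continuous_seqComb.isProperMap
  exact (isProperMap_id.prodMap h).isClosedMap.isQuotientMap (continuous_id.prodMap
    continuous_seqComb) (Function.surjective_id.prodMap surjective_seqComb)

theorem exists_ge_of_seqComb_eq {k l : seqWeights × (ℕ → X)} (h : seqComb k = seqComb l) (i : ℕ)
    (hi : 0 < k.1.1 i) : ∃ j, l.2 j = k.2 i ∧ k.1.1 i ≤ l.1.1 j :=
  exists_ge_of_weightedComb_eq (seqWeights_le_one k.1.2)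
    l.1.2.2.1 (seqWeights_le_one l.1.2) (isGapWeight_of_mem_seqWeights l.1.2).finite
    ⟨0, by rw [l.1.2.1]; exact one_pos⟩ (congrArg Subtype.val h) hi

/-- Index 0 is the only one of weight 1, so the base point does not depend on the representation. -/
theorem exists_base_of_seqComb_eq {k l : seqWeights × (ℕ → X)} (h : seqComb k = seqComb l) :
    l.2 0 = k.2 0 := by
  obtain ⟨j, hj, hle⟩ := exists_ge_of_seqComb_eq h 0 (by rw [k.1.2.1]; exact one_pos)
  rw [k.1.2.1] at hle
  rcases Nat.eq_zero_or_pos j with rfl | hj0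
  · exact hj
  · exact absurd (seqWeights_lt_one l.1.2 hj0) (not_lt.2 hle)

/-- The point of mass `0` of an element of `I_f(X)`. -/
noncomputable def idemBase (μ : IdemMeasuresF X) : X :=
  (Function.surjInv surjective_seqComb μ).2 0

theorem idemBase_seqComb (k : seqWeights × (ℕ → X)) : idemBase (seqComb k) = k.2 0 :=
  exists_base_of_seqComb_eq (Function.surjInv_eq surjective_seqComb _).symm

theorem continuous_idemBase : Continuous (idemBase (X := X)) := by
  have hq : IsQuotientMap (seqComb (X := X)) :=
    continuous_seqComb.isClosedMap.isQuotientMap continuous_seqComb surjective_seqComb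
  rw [hq.continuous_iff]
  have : idemBase ∘ seqComb = fun k : seqWeights × (ℕ → X) => k.2 0 := funext idemBase_seqComb
  rw [this]
  fun_prop

/-- On a compact space, countably many continuous functions separating points suffice; here they are
the evaluations at a dense sequence in `C(X, ℝ)`. -/
theorem metrizableSpace_idemMeasuresF [TopologicalSpace.MetrizableSpace X] :
    TopologicalSpace.MetrizableSpace (IdemMeasuresF X) := by
  let _ : MetricSpace X := TopologicalSpace.metrizableSpaceMetric X
  refine Metric.PiNatEmbed.TopologicalSpace.MetrizableSpace.of_countable_separating
    (fun (n : ℕ) (μ : IdemMeasuresF X) => μ.1 (TopologicalSpace.denseSeq C(X, ℝ) n))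
    (fun n => (continuous_apply _).comp continuous_subtype_val) fun μ ν hne => ?_
  by_contra! h
  refine hne (Subtype.ext ?_)
  refine (idemMeasures_continuous (idemMeasuresF_subset X μ.2)).ext_on
    (TopologicalSpace.denseRange_denseSeq C(X, ℝ))
    (idemMeasures_continuous (idemMeasuresF_subset X ν.2)) ?_
  rintro _ ⟨n, rfl⟩
  exact h n

end Continuity

/-! ### Lowering the weights of the points other than the base point -/

section Operations

variable {X : Type*}

/-- A monotone rule that lowers the weights `s ∈ [0, 1]` of the points of `X`. -/
structure IsReweighting (F : X → ℝ → ℝ) : Prop where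
  nonneg : ∀ x s, 0 ≤ s → s ≤ 1 → 0 ≤ F x s
  le : ∀ x s, 0 ≤ s → s ≤ 1 → F x s ≤ s
  mono : ∀ x s t, 0 ≤ s → s ≤ t → t ≤ 1 → F x s ≤ F x t

/-- The reweighted sequence of weights; the weight of the base point is kept. -/
noncomputable def reweight (F : X → ℝ → ℝ) (s : ℕ → ℝ) (p : ℕ → X) : ℕ → ℝ :=
  fun i => if i = 0 then 1 else F (p i) (s i)

theorem reweight_of_ne {F : X → ℝ → ℝ} {s : ℕ → ℝ} {p : ℕ → X} {i : ℕ} (hi : i ≠ 0) :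
    reweight F s p i = F (p i) (s i) := if_neg hi

theorem IsReweighting.reweight_mem {F : X → ℝ → ℝ} (hF : IsReweighting F) {s : ℕ → ℝ}
    (hs : s ∈ seqWeights) (p : ℕ → X) : reweight F s p ∈ seqWeights := by
  have h01 := fun i => And.intro (hs.2.1 i) (seqWeights_le_one hs i)
  refine ⟨if_pos rfl, fun i => ?_, fun i j hi hj => ?_⟩
  · by_cases hi : i = 0
    · rw [hi]
      exact zero_le_one
    · rw [reweight_of_ne hi]
      exact hF.nonneg _ _ (h01 i).1 (h01 i).2
  · rw [reweight_of_ne (by omega), reweight_of_ne (by omega)]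
    rcases hs.2.2 i j hi hj with h | h
    · left
      have h1 := hF.nonneg (p i) _ (h01 i).1 (h01 i).2
      have h2 := hF.le (p i) _ (h01 i).1 (h01 i).2
      rw [h] at h1 h2 ⊢
      exact le_antisymm h2 h1
    · exact Or.inr ((hF.le _ _ (h01 j).1 (h01 j).2).trans h)

theorem IsReweighting.reweight_le_one {F : X → ℝ → ℝ} (hF : IsReweighting F) {s : ℕ → ℝ}
    (hs : s ∈ seqWeights) (p : ℕ → X) (i : ℕ) : reweight F s p i ≤ 1 :=
  seqWeights_le_one (hF.reweight_mem hs p) i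

end Operations

/-! ### Operations on I_f induced by moving points and lowering weights -/

section IdemOp

open Filter

variable {X : Type u} [TopologicalSpace X] [CompactSpace X] [T2Space X]
  {Y : Type*} [TopologicalSpace Y] [CompactSpace Y] [T2Space Y]

/-- The operation on measures that moves the points by `g` and, except for the base point, lowers
the weights by `F`. -/
noncomputable def idemOp {F : X → ℝ → ℝ} (hF : IsReweighting F) (g : X → Y)
    (μ : IdemMeasuresF X) : IdemMeasuresF Y :=
  let k := Function.surjInv surjective_seqComb μ
  seqComb (⟨reweight F k.1.1 k.2, hF.reweight_mem k.1.2 k.2⟩, g ∘ k.2)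

/-- Independence of the chosen representation: it determines the base point and the largest weight
at each point, and a monotone rule respects the largest weight. -/
theorem idemOp_seqComb {F : X → ℝ → ℝ} (hF : IsReweighting F) (g : X → Y)
    (k : seqWeights × (ℕ → X)) :
    idemOp hF g (seqComb k) =
      seqComb (⟨reweight F k.1.1 k.2, hF.reweight_mem k.1.2 k.2⟩, g ∘ k.2) := by
  have key : ∀ k l : seqWeights × (ℕ → X), seqComb k = seqComb l → ∀ i,
      0 < reweight F k.1.1 k.2 i → ∃ j, (g ∘ l.2) j = (g ∘ k.2) i ∧
        reweight F k.1.1 k.2 i ≤ reweight F l.1.1 l.2 j := by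
    intro k l h i hi
    rcases eq_or_ne i 0 with rfl | hi0
    · exact ⟨0, congrArg g (exists_base_of_seqComb_eq h), le_rfl⟩
    · have hki := hi
      rw [reweight_of_ne hi0] at hki
      have hpos : 0 < k.1.1 i :=
        hki.trans_le (hF.le _ _ (k.1.2.2.1 i) (seqWeights_le_one k.1.2 i))
      obtain ⟨j, hj, hle⟩ := exists_ge_of_seqComb_eq h i hpos
      refine ⟨j, congrArg g hj, ?_⟩
      rcases eq_or_ne j 0 with rfl | hj0
      · exact hF.reweight_le_one k.1.2 k.2 i
      · rw [reweight_of_ne hi0, reweight_of_ne hj0, hj]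
        exact hF.mono _ _ _ hpos.le hle (seqWeights_le_one l.1.2 j)
  have hk := Function.surjInv_eq surjective_seqComb (seqComb k)
  refine Subtype.ext (weightedComb_congr ?_ ?_ ?_ ?_ (key _ _ hk) (key _ _ hk.symm))
  · exact (hF.reweight_mem (Subtype.prop _) _).2.1
  · exact hF.reweight_le_one (Subtype.prop _) _
  · exact (hF.reweight_mem (Subtype.prop _) _).2.1
  · exact hF.reweight_le_one (Subtype.prop _) _

/-- The base point keeps weight 1, so `g` must be continuous at the base points that occur. For
other points only `F` times a function of `g` has to be continuous, which allows `g` to be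
discontinuous where `F` vanishes. -/
theorem continuousOn_idemOp {Λ : Type*} [TopologicalSpace Λ] {F : Λ → X → ℝ → ℝ}
    (hF : ∀ t, IsReweighting (F t)) {g : Λ → X → Y} {Ω : Set (Λ × IdemMeasuresF X)}
    (hΩ : IsOpen Ω)
    (hg : ContinuousOn (fun z : Λ × X => g z.1 z.2)
      {z | ∃ μ, (z.1, μ) ∈ Ω ∧ idemBase μ = z.2})
    (hFg : ∀ ψ : C(Y, ℝ), Continuous fun z : Λ × X × ℝ =>
      F z.1 z.2.1 z.2.2 * Real.exp (ψ (g z.1 z.2.1))) :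
    ContinuousOn (fun z : Λ × IdemMeasuresF X => idemOp (hF z.1) (g z.1) z.2) Ω := by
  rw [(isQuotientMap_prodMap_seqComb Λ).continuousOn_isOpen_iff hΩ]
  have heq : (fun z : Λ × IdemMeasuresF X => idemOp (hF z.1) (g z.1) z.2) ∘ Prod.map id seqComb =
      fun z : Λ × (seqWeights × (ℕ → X)) =>
        seqComb (⟨reweight (F z.1) z.2.1.1 z.2.2, (hF z.1).reweight_mem z.2.1.2 z.2.2⟩,
          g z.1 ∘ z.2.2) :=
    funext fun z => idemOp_seqComb (hF z.1) (g z.1) z.2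
  rw [heq, IsInducing.subtypeVal.continuousOn_iff]
  refine continuousOn_weightedComb
    (w := fun z : Λ × (seqWeights × (ℕ → X)) => reweight (F z.1) z.2.1.1 z.2.2)
    (p := fun z => g z.1 ∘ z.2.2) (fun z => (hF z.1).reweight_mem z.2.1.2 z.2.2) fun ψ i => ?_
  rcases eq_or_ne i 0 with rfl | hi
  · have h1 : ContinuousOn (fun z : Λ × (seqWeights × (ℕ → X)) => g z.1 (z.2.2 0))
        (Prod.map id seqComb ⁻¹' Ω) := by
      refine hg.comp (f := fun z : Λ × (seqWeights × (ℕ → X)) => (z.1, z.2.2 0))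
        (Continuous.continuousOn (by fun_prop)) fun z hz => ?_
      exact ⟨seqComb z.2, hz, idemBase_seqComb z.2⟩
    have h2 : ContinuousOn (fun z : Λ × (seqWeights × (ℕ → X)) =>
        Real.exp (ψ (g z.1 (z.2.2 0)))) (Prod.map id seqComb ⁻¹' Ω) :=
      (Real.continuous_exp.comp ψ.continuous).comp_continuousOn h1
    simpa [reweight] using h2
  · simp only [reweight_of_ne hi]
    exact ((hFg ψ).comp (g := fun z : Λ × X × ℝ => F z.1 z.2.1 z.2.2 * Real.exp (ψ (g z.1 z.2.1)))
      (f := fun z : Λ × (seqWeights × (ℕ → X)) => (z.1, z.2.2 i, z.2.1.1 i))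
      (continuous_fst.prodMk (((continuous_apply i).comp (continuous_snd.comp continuous_snd)).prodMk
        ((continuous_apply i).comp (continuous_subtype_val.comp
          (continuous_fst.comp continuous_snd)))))).continuousOn

theorem continuousOn_idemOp_fixed {F : X → ℝ → ℝ} (hF : IsReweighting F) {g : X → Y}
    {Ω : Set (IdemMeasuresF X)} (hΩ : IsOpen Ω) (hg : ContinuousOn g (idemBase '' Ω))
    (hFg : ∀ ψ : C(Y, ℝ), Continuous fun z : X × ℝ => F z.1 z.2 * Real.exp (ψ (g z.1))) :
    ContinuousOn (idemOp hF g) Ω := by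
  have hg' : ContinuousOn (fun z : Unit × X => g z.2)
      {z | ∃ μ, (z.1, μ) ∈ (Prod.snd ⁻¹' Ω : Set (Unit × IdemMeasuresF X)) ∧
        idemBase μ = z.2} :=
    ContinuousOn.comp (g := g) (f := fun z : Unit × X => z.2) hg continuousOn_snd
      fun z ⟨μ, hμ, hz⟩ => ⟨μ, hμ, hz⟩
  have hFg' : ∀ ψ : C(Y, ℝ), Continuous fun z : Unit × X × ℝ =>
      F z.2.1 z.2.2 * Real.exp (ψ (g z.2.1)) := fun ψ =>
    Continuous.comp (g := fun z : X × ℝ => F z.1 z.2 * Real.exp (ψ (g z.1))) (hFg ψ)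
      (continuous_snd : Continuous fun z : Unit × X × ℝ => z.2)
  have h : ContinuousOn (fun z : Unit × IdemMeasuresF X => idemOp hF g z.2) (Prod.snd ⁻¹' Ω) :=
    continuousOn_idemOp (Λ := Unit) (F := fun _ => F) (fun _ => hF) (g := fun _ => g)
      (hΩ.preimage continuous_snd) hg' hFg'
  have hi : Continuous fun μ : IdemMeasuresF X => ((), μ) := Continuous.prodMk_right ()
  exact ContinuousOn.comp (f := fun μ : IdemMeasuresF X => ((), μ)) h hi.continuousOn
    fun μ hμ => hμ

end IdemOp

/-! ### Measures over the Hilbert cube: finite levels and their convex cells -/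

section Hilbert

open Filter

/-- The Hilbert cube. -/
abbrev HilbertCube : Type := ℕ → unitInterval

theorem PiNat.firstDiff_eq_of {E : ℕ → Type*} {x y : ∀ n, E n} {k : ℕ} (hk : x k ≠ y k)
    (h : ∀ l < k, x l = y l) : PiNat.firstDiff x y = k := by
  have hne : x ≠ y := fun e => hk (by rw [e])
  refine le_antisymm ?_ ?_
  · by_contra! hlt
    exact hk (PiNat.apply_eq_of_lt_firstDiff hlt)
  · by_contra! hlt
    exact PiNat.apply_firstDiff_ne hne (h _ hlt)

theorem PiNat.le_firstDiff_of {E : ℕ → Type*} {x y : ∀ n, E n} {k : ℕ} (hne : x ≠ y)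
    (h : ∀ l < k, x l = y l) : k ≤ PiNat.firstDiff x y := by
  by_contra! hlt
  exact PiNat.apply_firstDiff_ne hne (h _ hlt)

theorem PiNat.firstDiff_self_eq_zero {E : ℕ → Type*} (x : ∀ n, E n) :
    PiNat.firstDiff x x = 0 := by
  simp [PiNat.firstDiff_def]

/-- The measures in `I_f` of the Hilbert cube with at most `N` support points, all of which have
zero coordinates from the index `N` on. -/
def finiteLevel (N : ℕ) : Set (IdemMeasuresF HilbertCube) :=
  {μ | ∃ (S : Finset HilbertCube) (hS : S.Nonempty) (c : HilbertCube → ℝ) (x₀ : HilbertCube),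
    IsGapMass S c x₀ ∧ S.card ≤ N ∧ (∀ x ∈ S, ∀ l, N ≤ l → x l = 0) ∧
      μ.1 = maxPlusComb S hS c}

theorem monotone_finiteLevel : Monotone finiteLevel := by
  rintro N N' h μ ⟨S, hS, c, x₀, h1, h2, h3, h4⟩
  exact ⟨S, hS, c, x₀, h1, h2.trans h, fun x hx l hl => h3 x hx l (h.trans hl), h4⟩

variable {N : ℕ}

/-- The coordinates of `N` points of an `N`-dimensional cube, followed by `N` weights. -/
abbrev CellSpace (N : ℕ) : Type := EuclideanSpace ℝ (Fin N × Fin N ⊕ Fin N)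

/-- The points of the Hilbert cube with the given coordinates. -/
noncomputable def cellPoint (x : CellSpace N) (i : Fin N) : HilbertCube :=
  fun l => if h : l < N then projIcc 0 1 zero_le_one (x (Sum.inl (i, ⟨l, h⟩))) else 0

/-- The weights of the points. -/
def cellWeight (x : CellSpace N) (i : Fin N) : ℝ := x (Sum.inr i)

/-- The type of a cell: the number of points, for each pair of points the first coordinate in which
they differ, and the index of the base point. -/
abbrev CellType (N : ℕ) : Type := Fin (N + 1) × (Fin N → Fin N → Fin N) × Fin N

/-- The closed cell of type `c`. In its interior, the first `c.1` points are distinct and in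
lexicographic order, and `c.2.1 i j` is the first coordinate in which the points `i` and `j`
differ. -/
structure InCell (c : CellType N) (x : CellSpace N) : Prop where
  base_lt : (c.2.2 : ℕ) < c.1
  -- The conditions on the discrete data, like `coord_zero` and `weight_zero` below, normalize
  -- redundant entries, so that a measure determines its open cell and its point there.
  diff_symm : ∀ i j, c.2.1 i j = c.2.1 j i
  diff_self : ∀ i, (c.2.1 i i : ℕ) = 0
  diff_of_le : ∀ i j : Fin N, (c.1 : ℕ) ≤ i → (c.2.1 i j : ℕ) = 0
  coord_nonneg : ∀ i l, 0 ≤ x (Sum.inl (i, l))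
  coord_le : ∀ i l, x (Sum.inl (i, l)) ≤ 1
  coord_zero : ∀ i : Fin N, (c.1 : ℕ) ≤ i → ∀ l, x (Sum.inl (i, l)) = 0
  weight_nonneg : ∀ i, 0 ≤ x (Sum.inr i)
  weight_base : x (Sum.inr c.2.2) = 1
  weight_gap : ∀ i, i ≠ c.2.2 → x (Sum.inr i) * ((c.1 : ℕ) + 1 : ℝ) ≤ 1
  weight_zero : ∀ i : Fin N, (c.1 : ℕ) ≤ i → x (Sum.inr i) = 0
  coord_eq : ∀ i j : Fin N, i < j → (j : ℕ) < c.1 → ∀ l < c.2.1 i j,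
    x (Sum.inl (i, l)) = x (Sum.inl (j, l))
  coord_mono : ∀ i j : Fin N, i < j → (j : ℕ) < c.1 →
    x (Sum.inl (i, c.2.1 i j)) ≤ x (Sum.inl (j, c.2.1 i j))

/-- The faces of a cell: two points have a larger first difference, or a weight vanishes. -/
def cellFace (c : CellType N) : Fin N × Fin N ⊕ Fin N → Set (CellSpace N)
  | Sum.inl (i, j) => {x | i < j ∧ (j : ℕ) < c.1 ∧
      x (Sum.inl (i, c.2.1 i j)) = x (Sum.inl (j, c.2.1 i j))}
  | Sum.inr i => {x | (i : ℕ) < c.1 ∧ x (Sum.inr i) = 0}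

/-- The closed cell as a set. -/
def cellSet (c : CellType N) : Set (CellSpace N) := {x | InCell c x}

/-- The part of the boundary of a cell along which it is attached. -/
def cellBoundary (c : CellType N) : Set (CellSpace N) :=
  ⋃ f ∈ (Finset.univ : Finset (Fin N × Fin N ⊕ Fin N)), cellSet c ∩ cellFace c f

theorem isClosed_cellSet (c : CellType N) : IsClosed (cellSet c) := by
  refine IsSeqClosed.isClosed fun u x hu hx => ?_
  have hk : ∀ k, Tendsto (fun n => u n k) atTop (𝓝 (x k)) := fun k =>
    ((PiLp.continuous_apply 2 _ k).tendsto x).comp hx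
  have h0 : InCell c (u 0) := hu 0
  have hu' : ∀ n, InCell c (u n) := hu
  exact
    { base_lt := h0.base_lt
      diff_symm := h0.diff_symm
      diff_self := h0.diff_self
      diff_of_le := h0.diff_of_le
      coord_nonneg := fun i l => ge_of_tendsto' (hk _) fun n => (hu' n).coord_nonneg i l
      coord_le := fun i l => le_of_tendsto' (hk _) fun n => (hu' n).coord_le i l
      coord_zero := fun i hi l => tendsto_nhds_unique (hk _)
        (tendsto_const_nhds.congr fun n => ((hu' n).coord_zero i hi l).symm)
      weight_nonneg := fun i => ge_of_tendsto' (hk _) fun n => (hu' n).weight_nonneg i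
      weight_base := tendsto_nhds_unique (hk _)
        (tendsto_const_nhds.congr fun n => (hu' n).weight_base.symm)
      weight_gap := fun i hi => le_of_tendsto' ((hk _).mul_const _) fun n => (hu' n).weight_gap i hi
      weight_zero := fun i hi => tendsto_nhds_unique (hk _)
        (tendsto_const_nhds.congr fun n => ((hu' n).weight_zero i hi).symm)
      coord_eq := fun i j hij hj l hl => tendsto_nhds_unique (hk _)
        ((hk _).congr fun n => ((hu' n).coord_eq i j hij hj l hl).symm)
      coord_mono := fun i j hij hj => le_of_tendsto_of_tendsto' (hk _) (hk _) fun n =>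
        (hu' n).coord_mono i j hij hj }

theorem InCell.weight_le_one {c : CellType N} {x : CellSpace N} (h : InCell c x) (i : Fin N) :
    x (Sum.inr i) ≤ 1 := by
  by_cases hi : i = c.2.2
  · rw [hi, h.weight_base]
  · have h1 := h.weight_gap i hi
    have h2 := h.weight_nonneg i
    have h3 : (0 : ℝ) ≤ (c.1 : ℕ) := Nat.cast_nonneg _
    nlinarith

theorem isCompact_cellSet (c : CellType N) : IsCompact (cellSet c) := by
  let e := (EuclideanSpace.equiv (Fin N × Fin N ⊕ Fin N) ℝ).toHomeomorph
  have h : IsCompact (e ⁻¹' Icc 0 1) := e.isCompact_preimage.2 isCompact_Icc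
  refine h.of_isClosed_subset (isClosed_cellSet c) fun x hx => ?_
  have hx : InCell c x := hx
  refine ⟨fun k => ?_, fun k => ?_⟩
  · rcases k with ⟨i, l⟩ | i
    · exact hx.coord_nonneg i l
    · exact hx.weight_nonneg i
  · rcases k with ⟨i, l⟩ | i
    · exact hx.coord_le i l
    · exact hx.weight_le_one i

theorem convex_cellSet (c : CellType N) : Convex ℝ (cellSet c) := by
  intro x hx y hy a b ha hb hab
  have hx : InCell c x := hx
  have hy : InCell c y := hy
  have hk : ∀ k, (a • x + b • y) k = a * x k + b * y k := fun k => by simp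
  have hle : ∀ {r s t : ℝ}, r ≤ t → s ≤ t → a * r + b * s ≤ t := fun hr hs =>
    (add_le_add (mul_le_mul_of_nonneg_left hr ha) (mul_le_mul_of_nonneg_left hs hb)).trans
      (by rw [← add_mul, hab, one_mul])
  exact
    { base_lt := hx.base_lt
      diff_symm := hx.diff_symm
      diff_self := hx.diff_self
      diff_of_le := hx.diff_of_le
      coord_nonneg := fun i l => by
        rw [hk]
        exact add_nonneg (mul_nonneg ha (hx.coord_nonneg i l)) (mul_nonneg hb (hy.coord_nonneg i l))
      coord_le := fun i l => by
        rw [hk]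
        exact hle (hx.coord_le i l) (hy.coord_le i l)
      coord_zero := fun i hi l => by
        rw [hk, hx.coord_zero i hi l, hy.coord_zero i hi l]
        simp
      weight_nonneg := fun i => by
        rw [hk]
        exact add_nonneg (mul_nonneg ha (hx.weight_nonneg i)) (mul_nonneg hb (hy.weight_nonneg i))
      weight_base := by rw [hk, hx.weight_base, hy.weight_base, mul_one, mul_one, hab]
      weight_gap := fun i hi => by
        rw [hk, add_mul, mul_assoc, mul_assoc]
        exact hle (hx.weight_gap i hi) (hy.weight_gap i hi)
      weight_zero := fun i hi => by
        rw [hk, hx.weight_zero i hi, hy.weight_zero i hi]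
        simp
      coord_eq := fun i j hij hj l hl => by
        rw [hk, hk, hx.coord_eq i j hij hj l hl, hy.coord_eq i j hij hj l hl]
      coord_mono := fun i j hij hj => by
        rw [hk, hk]
        exact add_le_add (mul_le_mul_of_nonneg_left (hx.coord_mono i j hij hj) ha)
          (mul_le_mul_of_nonneg_left (hy.coord_mono i j hij hj) hb) }

theorem isClosed_cellFace (c : CellType N) (f : Fin N × Fin N ⊕ Fin N) :
    IsClosed (cellFace c f) := by
  have hc : ∀ k, Continuous fun x : CellSpace N => x k := fun k => PiLp.continuous_apply 2 _ k
  rcases f with ⟨i, j⟩ | i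
  · exact isClosed_const.and (isClosed_const.and (isClosed_eq (hc _) (hc _)))
  · exact isClosed_const.and (isClosed_eq (hc _) continuous_const)

theorem convex_cellFace (c : CellType N) (f : Fin N × Fin N ⊕ Fin N) :
    Convex ℝ (cellFace c f) := by
  intro x hx y hy a b _ _ _
  have hk : ∀ k, (a • x + b • y) k = a * x k + b * y k := fun k => by simp
  rcases f with ⟨i, j⟩ | i
  · refine ⟨hx.1, hx.2.1, ?_⟩
    rw [hk, hk, hx.2.2, hy.2.2]
  · refine ⟨hx.1, ?_⟩
    rw [hk, hx.2, hy.2]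
    simp

theorem isANE_cellBoundary (c : CellType N) : IsANE.{0} (cellBoundary c) :=
  isANE_biUnion_convex _ _ (fun f _ => (isCompact_cellSet c).inter_right (isClosed_cellFace c f))
    fun f _ => (convex_cellSet c).inter (convex_cellFace c f)

theorem isClosed_cellBoundary (c : CellType N) : IsClosed (cellBoundary c) :=
  (Finset.univ.isCompact_biUnion fun f _ =>
    (isCompact_cellSet c).inter_right (isClosed_cellFace c f)).isClosed

theorem cellBoundary_subset (c : CellType N) : cellBoundary c ⊆ cellSet c :=
  iUnion₂_subset fun _ _ => inter_subset_left

theorem notMem_cellBoundary_iff {c : CellType N} {x : CellSpace N} (hx : InCell c x) :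
    x ∉ cellBoundary c ↔
      (∀ i j : Fin N, i < j → (j : ℕ) < c.1 →
        x (Sum.inl (i, c.2.1 i j)) < x (Sum.inl (j, c.2.1 i j))) ∧
      ∀ i : Fin N, (i : ℕ) < c.1 → 0 < x (Sum.inr i) := by
  have hmem : x ∈ cellBoundary c ↔ ∃ f, x ∈ cellFace c f := by
    simp only [cellBoundary, Finset.mem_univ, iUnion_true, mem_iUnion, mem_inter_iff]
    exact ⟨fun ⟨f, h⟩ => ⟨f, h.2⟩, fun ⟨f, h⟩ => ⟨f, hx, h⟩⟩
  rw [hmem]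
  constructor
  · intro h
    refine ⟨fun i j hij hj => (hx.coord_mono i j hij hj).lt_of_ne fun e =>
      h ⟨Sum.inl (i, j), hij, hj, e⟩, fun i hi => (hx.weight_nonneg i).lt_of_ne' fun e =>
      h ⟨Sum.inr i, hi, e⟩⟩
  · rintro ⟨h1, h2⟩ ⟨⟨i, j⟩ | i, hf⟩
    · exact (h1 i j hf.1 hf.2.1).ne hf.2.2
    · exact (h2 i hf.1).ne' hf.2

end Hilbert

/-! ### The open cells partition a finite level -/

section CellStructure

open Filter

variable {N : ℕ}

theorem InCell.coe_cellPoint {c : CellType N} {x : CellSpace N} (hx : InCell c x) (i l : Fin N) :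
    (cellPoint x i l : ℝ) = x (Sum.inl (i, l)) := by
  have hmem : x (Sum.inl (i, l)) ∈ Icc (0 : ℝ) 1 := ⟨hx.coord_nonneg i l, hx.coord_le i l⟩
  simp only [cellPoint, dif_pos l.2, Fin.eta]
  rw [projIcc_of_mem zero_le_one hmem]

theorem cellPoint_of_le (x : CellSpace N) (i : Fin N) {l : ℕ} (hl : N ≤ l) :
    cellPoint x i l = 0 := dif_neg (not_lt.2 hl)

/-- The indices of the points that occur in a cell of type `c`. -/
def cellIndices (c : CellType N) : Finset (Fin N) :=
  Finset.univ.filter fun i => (i : ℕ) < c.1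

theorem mem_cellIndices {c : CellType N} {i : Fin N} : i ∈ cellIndices c ↔ (i : ℕ) < c.1 := by
  simp [cellIndices]

theorem card_cellIndices (c : CellType N) : (cellIndices c).card = c.1 := by
  rw [cellIndices, Fin.card_filter_val_lt, min_eq_right (Nat.lt_succ_iff.1 c.1.2)]

theorem InCell.mem_cellIndices_of_pos {c : CellType N} {x : CellSpace N} (hx : InCell c x)
    {i : Fin N} (hi : cellWeight x i ≠ 0) : i ∈ cellIndices c := by
  rw [mem_cellIndices]
  by_contra! h
  exact hi (hx.weight_zero i h)

theorem InCell.isGapWeight {c : CellType N} {x : CellSpace N} (hx : InCell c x) :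
    IsGapWeight (cellWeight x) c.2.2 := by
  refine ⟨hx.weight_nonneg, hx.weight_base, Set.toFinite _, fun i hi => ?_⟩
  refine le_trans ?_ (hx.weight_gap i hi)
  have h1 : Function.support (cellWeight x) ⊆ cellIndices c := fun j hj =>
    hx.mem_cellIndices_of_pos hj
  have h2 := Set.ncard_le_ncard h1
  rw [Set.ncard_coe_finset, card_cellIndices] at h2
  have h3 : ((Function.support (cellWeight x)).ncard : ℝ) ≤ (c.1 : ℕ) := by exact_mod_cast h2
  exact mul_le_mul_of_nonneg_left (by linarith) (hx.weight_nonneg i)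

instance : Nonempty (IdemMeasuresF HilbertCube) := by
  refine ⟨seqComb (⟨fun i => if i = 0 then 1 else 0, if_pos rfl, fun i => ?_, fun i j hi _ => ?_⟩,
    fun _ => 0)⟩
  · dsimp only
    split_ifs <;> norm_num
  · exact Or.inl (if_neg (by omega))

open Classical in
/-- The measure with the given points and weights. -/
noncomputable def cellMap (x : CellSpace N) : IdemMeasuresF HilbertCube :=
  if h : weightedComb (cellWeight x) (cellPoint x) ∈ IdemMeasuresF HilbertCube then ⟨_, h⟩
  else Classical.arbitrary _

theorem InCell.coe_cellMap {c : CellType N} {x : CellSpace N} (hx : InCell c x) :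
    (cellMap x).1 = weightedComb (cellWeight x) (cellPoint x) := by
  rw [cellMap, dif_pos (hx.isGapWeight.weightedComb_mem _)]

theorem continuousOn_cellMap (c : CellType N) : ContinuousOn cellMap (cellSet c) := by
  rw [IsInducing.subtypeVal.continuousOn_iff]
  have h : ContinuousOn (fun x => weightedComb (cellWeight x) (cellPoint x)) (cellSet c) := by
    refine continuousOn_pi.2 fun ψ => ContinuousOn.log ?_ fun x hx => ?_
    · have : Nonempty (Fin N) := ⟨c.2.2⟩
      simp only [← Finset.sup'_univ_eq_ciSup]
      refine Continuous.continuousOn (Continuous.finset_sup'_apply _ fun i _ => ?_)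
      have hp : Continuous fun x : CellSpace N => cellPoint x i := by
        refine continuous_pi fun l => ?_
        by_cases hl : l < N
        · simp only [cellPoint, dif_pos hl]
          exact continuous_projIcc.comp (PiLp.continuous_apply 2 _ _)
        · simp only [cellPoint, dif_neg hl]
          exact continuous_const
      have hw : Continuous fun x : CellSpace N => cellWeight x i := PiLp.continuous_apply 2 _ _
      exact hw.mul (Real.continuous_exp.comp (ψ.continuous.comp hp))
    · have hx : InCell c x := hx
      refine (iSup_weights_pos _ hx.isGapWeight.le_one (b := c.2.2) ?_ ψ).ne'
      rw [hx.isGapWeight.base]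
      exact one_pos
  exact h.congr fun x hx => InCell.coe_cellMap (c := c) hx

open Classical in
/-- The set of the points of positive weight. -/
noncomputable def cellSupport (x : CellSpace N) : Finset HilbertCube :=
  (Finset.univ.filter fun i => 0 < cellWeight x i).image (cellPoint x)

theorem mem_cellSupport {x : CellSpace N} {z : HilbertCube} :
    z ∈ cellSupport x ↔ ∃ i, 0 < cellWeight x i ∧ cellPoint x i = z := by
  simp [cellSupport]

theorem InCell.exists_ge {c c' : CellType N} {x y : CellSpace N} (hx : InCell c x)
    (hy : InCell c' y) (h : cellMap x = cellMap y) {i : Fin N} (hi : 0 < cellWeight x i) :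
    ∃ j, cellPoint y j = cellPoint x i ∧ cellWeight x i ≤ cellWeight y j := by
  refine exists_ge_of_weightedComb_eq hx.isGapWeight.le_one hy.isGapWeight.nonneg
    hy.isGapWeight.le_one hy.isGapWeight.finite ⟨c'.2.2, ?_⟩ ?_ hi
  · rw [hy.isGapWeight.base]
    exact one_pos
  · rw [← hx.coe_cellMap, ← hy.coe_cellMap, h]

theorem InCell.cellSupport_eq {c c' : CellType N} {x y : CellSpace N} (hx : InCell c x)
    (hy : InCell c' y) (h : cellMap x = cellMap y) : cellSupport x = cellSupport y := by
  have key : ∀ {c c' : CellType N} {x y : CellSpace N}, InCell c x → InCell c' y →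
      cellMap x = cellMap y → cellSupport x ⊆ cellSupport y := by
    intro c c' x y hx hy h z hz
    obtain ⟨i, hi, rfl⟩ := mem_cellSupport.1 hz
    obtain ⟨j, hj, hle⟩ := hx.exists_ge hy h hi
    exact mem_cellSupport.2 ⟨j, hi.trans_le hle, hj⟩
  exact (key hx hy h).antisymm (key hy hx h.symm)

/-- The rank of a cell: cells with fewer points come first, and among the cells with the same
number of points those with larger first differences. -/
def cellRank (c : CellType N) : ℤ ×ₗ ℤ :=
  toLex (((c.1 : ℕ) : ℤ), -∑ i ∈ cellIndices c, ∑ j ∈ cellIndices c, ((c.2.1 i j : ℕ) : ℤ))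

/-- The rank of the open cell that contains a given measure, in terms of the support. -/
noncomputable def supportRank (S : Finset HilbertCube) : ℤ ×ₗ ℤ :=
  toLex ((S.card : ℤ), -∑ x ∈ S, ∑ y ∈ S, ((PiNat.firstDiff x y : ℕ) : ℤ))

theorem InCell.cellPoint_apply_eq {c : CellType N} {x : CellSpace N} (hx : InCell c x)
    {i j : Fin N} (hi : i ∈ cellIndices c) (hj : j ∈ cellIndices c) {l : ℕ}
    (hl : l < c.2.1 i j) : cellPoint x i l = cellPoint x j l := by
  have key : ∀ i j : Fin N, i < j → j ∈ cellIndices c → ∀ l : ℕ, l < c.2.1 i j →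
      cellPoint x i l = cellPoint x j l := by
    intro i j hij hj l hl
    have := hx.coord_eq i j hij (mem_cellIndices.1 hj) ⟨l, hl.trans (c.2.1 i j).2⟩ hl
    rw [← hx.coe_cellPoint, ← hx.coe_cellPoint] at this
    exact Subtype.ext this
  rcases lt_trichotomy i j with h | rfl | h
  · exact key i j h hj l hl
  · rfl
  · rw [hx.diff_symm] at hl
    exact (key j i h hi l hl).symm

section Interior

variable {c : CellType N} {x : CellSpace N}

/-- Off the boundary the coordinates at the recorded index differ strictly, so the index is exact.
On the closed cell it is only a lower bound for distinct points. -/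
theorem InCell.firstDiff_eq (hx : InCell c x) (hxB : x ∉ cellBoundary c) {i j : Fin N}
    (hi : i ∈ cellIndices c) (hj : j ∈ cellIndices c) :
    PiNat.firstDiff (cellPoint x i) (cellPoint x j) = c.2.1 i j := by
  have hB := ((notMem_cellBoundary_iff hx).1 hxB).1
  rcases lt_trichotomy i j with h | rfl | h
  · refine PiNat.firstDiff_eq_of (fun e => ?_) fun l hl => hx.cellPoint_apply_eq hi hj hl
    have h1 := hB i j h (mem_cellIndices.1 hj)
    rw [← hx.coe_cellPoint, ← hx.coe_cellPoint, e] at h1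
    exact lt_irrefl _ h1
  · rw [PiNat.firstDiff_self_eq_zero, hx.diff_self]
  · rw [PiNat.firstDiff_comm, hx.diff_symm]
    refine PiNat.firstDiff_eq_of (fun e => ?_) fun l hl => hx.cellPoint_apply_eq hj hi hl
    have h1 := hB j i h (mem_cellIndices.1 hi)
    rw [← hx.coe_cellPoint, ← hx.coe_cellPoint, e] at h1
    exact lt_irrefl _ h1

theorem InCell.toLex_lt (hx : InCell c x) (hxB : x ∉ cellBoundary c) {i j : Fin N}
    (hij : i < j) (hj : j ∈ cellIndices c) :
    toLex (cellPoint x i) < toLex (cellPoint x j) := by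
  have hi : i ∈ cellIndices c := mem_cellIndices.2 (lt_trans hij (mem_cellIndices.1 hj))
  refine ⟨c.2.1 i j, fun l hl => hx.cellPoint_apply_eq hi hj hl, ?_⟩
  have h1 := ((notMem_cellBoundary_iff hx).1 hxB).1 i j hij (mem_cellIndices.1 hj)
  rw [← hx.coe_cellPoint, ← hx.coe_cellPoint] at h1
  exact h1

theorem InCell.injOn_cellPoint (hx : InCell c x) (hxB : x ∉ cellBoundary c) :
    InjOn (cellPoint x) (cellIndices c) := by
  intro i hi j hj h
  rcases lt_trichotomy i j with hlt | heq | hlt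
  · have := hx.toLex_lt hxB hlt hj
    rw [h] at this
    exact absurd this (lt_irrefl _)
  · exact heq
  · have := hx.toLex_lt hxB hlt hi
    rw [h] at this
    exact absurd this (lt_irrefl _)

open Classical in
theorem InCell.cellSupport_eq_image (hx : InCell c x) (hxB : x ∉ cellBoundary c) :
    cellSupport x = (cellIndices c).image (cellPoint x) := by
  have hpos := ((notMem_cellBoundary_iff hx).1 hxB).2
  ext z
  rw [mem_cellSupport, Finset.mem_image]
  constructor
  · rintro ⟨i, hi, rfl⟩
    exact ⟨i, hx.mem_cellIndices_of_pos hi.ne', rfl⟩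
  · rintro ⟨i, hi, rfl⟩
    exact ⟨i, hpos i (mem_cellIndices.1 hi), rfl⟩

open Classical in
theorem supportRank_image {p : Fin N → HilbertCube} {A : Finset (Fin N)} (hp : InjOn p A) :
    supportRank (A.image p) = toLex ((A.card : ℤ),
      -∑ i ∈ A, ∑ j ∈ A, ((PiNat.firstDiff (p i) (p j) : ℕ) : ℤ)) := by
  rw [supportRank, Finset.card_image_of_injOn hp, Finset.sum_image hp]
  simp only [Finset.sum_image hp]

theorem InCell.supportRank_eq (hx : InCell c x) (hxB : x ∉ cellBoundary c) :
    supportRank (cellSupport x) = cellRank c := by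
  classical
  rw [hx.cellSupport_eq_image hxB, supportRank_image (hx.injOn_cellPoint hxB), cellRank,
    card_cellIndices]
  congr 3
  refine Finset.sum_congr rfl fun i hi => Finset.sum_congr rfl fun j hj => ?_
  rw [hx.firstDiff_eq hxB hi hj]

/-- If a weight vanishes or two points coincide, the support is smaller. Otherwise the points stay
distinct, no first difference drops below its recorded value, and the one belonging to the face
exceeds it; the minus sign in the rank turns this into a decrease. -/
theorem InCell.supportRank_lt (hx : InCell c x) (hxB : x ∈ cellBoundary c) :
    supportRank (cellSupport x) < cellRank c := by
  classical
  let A : Finset (Fin N) := Finset.univ.filter fun i => 0 < cellWeight x i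
  have hAc : A ⊆ cellIndices c := fun i hi =>
    hx.mem_cellIndices_of_pos (Finset.mem_filter.1 hi).2.ne'
  have hcA : A.card ≤ c.1 := (Finset.card_le_card hAc).trans (card_cellIndices c).le
  have himg : cellSupport x = A.image (cellPoint x) := rfl
  have hcard : (cellSupport x).card ≤ A.card := Finset.card_image_le
  rw [cellRank]
  rcases (hcard.trans hcA).lt_or_eq with hlt | heq
  · refine Prod.Lex.toLex_lt_toLex.2 (Or.inl (Int.ofNat_lt.2 hlt))
  have hAeq : A = cellIndices c :=
    Finset.eq_of_subset_of_card_le hAc (by rw [card_cellIndices]; omega)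
  have hinj : InjOn (cellPoint x) (cellIndices c) := by
    rw [← hAeq]
    exact Finset.card_image_iff.1 (by rw [← himg]; omega)
  rw [himg, hAeq, supportRank_image hinj, card_cellIndices]
  refine Prod.Lex.toLex_lt_toLex.2 (Or.inr ⟨rfl, neg_lt_neg ?_⟩)
  have hle : ∀ i ∈ cellIndices c, ∀ j ∈ cellIndices c,
      ((c.2.1 i j : ℕ) : ℤ) ≤ ((PiNat.firstDiff (cellPoint x i) (cellPoint x j) : ℕ) : ℤ) := by
    intro i hi j hj
    rcases eq_or_ne i j with rfl | hij
    · rw [hx.diff_self, PiNat.firstDiff_self_eq_zero]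
    · exact_mod_cast PiNat.le_firstDiff_of (fun e => hij (hinj hi hj e)) fun l hl =>
        hx.cellPoint_apply_eq hi hj hl
  simp only [cellBoundary, mem_iUnion] at hxB
  obtain ⟨⟨i, j⟩ | i, -, -, hf⟩ := hxB
  · obtain ⟨hij, hj, hf⟩ := hf
    have hj' : j ∈ cellIndices c := mem_cellIndices.2 hj
    have hi' : i ∈ cellIndices c := mem_cellIndices.2 (lt_trans hij hj)
    refine Finset.sum_lt_sum (fun a ha => Finset.sum_le_sum (hle a ha)) ⟨i, hi', ?_⟩
    refine Finset.sum_lt_sum (hle i hi') ⟨j, hj', ?_⟩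
    -- On this face the points agree at the recorded index as well.
    have : (c.2.1 i j : ℕ) + 1 ≤ PiNat.firstDiff (cellPoint x i) (cellPoint x j) := by
      refine PiNat.le_firstDiff_of (fun e => hij.ne (hinj hi' hj' e)) fun l hl => ?_
      rcases (Nat.lt_succ_iff.1 hl).lt_or_eq with h | h
      · exact hx.cellPoint_apply_eq hi' hj' h
      · rw [← hx.coe_cellPoint, ← hx.coe_cellPoint] at hf
        rw [h]
        exact Subtype.ext hf
    exact_mod_cast this
  · have : i ∈ A := by
      rw [hAeq]
      exact mem_cellIndices.2 hf.1
    exact absurd hf.2 (Finset.mem_filter.1 this).2.ne'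

end Interior

/-- Both families list the common support in strictly increasing lexicographic order, and such an
enumeration is unique. -/
theorem InCell.cellPoint_eq_of_cellMap_eq {c c' : CellType N} {x y : CellSpace N}
    (hx : InCell c x) (hxB : x ∉ cellBoundary c) (hy : InCell c' y) (hyB : y ∉ cellBoundary c')
    (h : cellMap x = cellMap y) :
    c.1 = c'.1 ∧ ∀ i ∈ cellIndices c, cellPoint x i = cellPoint y i := by
  classical
  have hS := hx.cellSupport_eq hy h
  rw [hx.cellSupport_eq_image hxB, hy.cellSupport_eq_image hyB] at hS
  have hn : c.1 = c'.1 := by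
    have := congrArg Finset.card hS
    rw [Finset.card_image_of_injOn (hx.injOn_cellPoint hxB),
      Finset.card_image_of_injOn (hy.injOn_cellPoint hyB), card_cellIndices,
      card_cellIndices] at this
    exact Fin.ext this
  have hA : cellIndices c' = cellIndices c := by rw [cellIndices, cellIndices, hn]
  refine ⟨hn, ?_⟩
  rw [hA] at hS
  let f : {i // i ∈ cellIndices c} → Lex HilbertCube := fun i => toLex (cellPoint x i)
  let g : {i // i ∈ cellIndices c} → Lex HilbertCube := fun i => toLex (cellPoint y i)
  have hf : StrictMono f := fun i j hij => hx.toLex_lt hxB hij j.2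
  have hg : StrictMono g := fun i j hij => hy.toLex_lt hyB hij (by rw [hA]; exact j.2)
  have hfg : f = g := by
    rw [← hf.range_inj hg]
    ext z
    have hz := Finset.ext_iff.1 hS (ofLex z)
    simp only [Finset.mem_image] at hz
    constructor
    · rintro ⟨i, rfl⟩
      obtain ⟨j, hj, hji⟩ := hz.1 ⟨i, i.2, rfl⟩
      exact ⟨⟨j, hj⟩, congrArg toLex hji⟩
    · rintro ⟨i, rfl⟩
      obtain ⟨j, hj, hji⟩ := hz.2 ⟨i, i.2, rfl⟩
      exact ⟨⟨j, hj⟩, congrArg toLex hji⟩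
  intro i hi
  exact congrArg ofLex (congrFun hfg ⟨i, hi⟩)

/-- Once the enumerated points agree, first differences give the type, the unique weight 1 gives the
base index, and distinctness of the points lets weights be compared index by index. -/
theorem InCell.eq_of_cellMap_eq {c c' : CellType N} {x y : CellSpace N} (hx : InCell c x)
    (hxB : x ∉ cellBoundary c) (hy : InCell c' y) (hyB : y ∉ cellBoundary c')
    (h : cellMap x = cellMap y) : c = c' ∧ x = y := by
  obtain ⟨hn, hp⟩ := hx.cellPoint_eq_of_cellMap_eq hxB hy hyB h
  have hA : cellIndices c' = cellIndices c := by rw [cellIndices, cellIndices, hn]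
  have hbase : c.2.2 = c'.2.2 := by
    have hb : c.2.2 ∈ cellIndices c := mem_cellIndices.2 hx.base_lt
    have hw : cellWeight x c.2.2 = 1 := hx.weight_base
    obtain ⟨j, hj, hle⟩ := hx.exists_ge hy h (i := c.2.2) (by rw [hw]; exact one_pos)
    have hjb : j = c'.2.2 := by
      by_contra hne
      exact absurd (hy.isGapWeight.lt_one hne) (not_lt.2 (hw ▸ hle))
    subst hjb
    rw [hp _ hb] at hj
    exact (hy.injOn_cellPoint hyB (mem_cellIndices.2 hy.base_lt) (by rw [hA]; exact hb) hj).symm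
  have hdiff : c.2.1 = c'.2.1 := by
    funext i j
    refine Fin.ext ?_
    by_cases hi : i ∈ cellIndices c
    · by_cases hj : j ∈ cellIndices c
      · rw [← hx.firstDiff_eq hxB hi hj, hp i hi, hp j hj,
          hy.firstDiff_eq hyB (by rwa [hA]) (by rwa [hA])]
      · rw [mem_cellIndices, not_lt] at hj
        rw [hx.diff_symm, hy.diff_symm, hx.diff_of_le j i hj, hy.diff_of_le j i (hn ▸ hj)]
    · rw [mem_cellIndices, not_lt] at hi
      rw [hx.diff_of_le i j hi, hy.diff_of_le i j (hn ▸ hi)]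
  have hwle : ∀ {c c' : CellType N} {x y : CellSpace N}, InCell c x → x ∉ cellBoundary c →
      InCell c' y → y ∉ cellBoundary c' → cellMap x = cellMap y → c.1 = c'.1 →
      (∀ i ∈ cellIndices c, cellPoint x i = cellPoint y i) → ∀ i ∈ cellIndices c,
      cellWeight x i ≤ cellWeight y i := by
    intro c c' x y hx hxB hy hyB h hn hp i hi
    have hA : cellIndices c' = cellIndices c := by rw [cellIndices, cellIndices, hn]
    have hpos := ((notMem_cellBoundary_iff hx).1 hxB).2 i (mem_cellIndices.1 hi)
    obtain ⟨j, hj, hle⟩ := hx.exists_ge hy h (i := i) hpos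
    rw [hp i hi] at hj
    have hj' : j ∈ cellIndices c' := hy.mem_cellIndices_of_pos (hpos.trans_le hle).ne'
    rwa [hy.injOn_cellPoint hyB hj' (by rw [hA]; exact hi) hj] at hle
  refine ⟨Prod.ext hn (Prod.ext hdiff hbase), ?_⟩
  ext k
  rcases k with ⟨i, l⟩ | i
  · rw [← hx.coe_cellPoint, ← hy.coe_cellPoint]
    by_cases hi : i ∈ cellIndices c
    · rw [hp i hi]
    · rw [mem_cellIndices, not_lt] at hi
      rw [hx.coe_cellPoint, hy.coe_cellPoint, hx.coord_zero i hi, hy.coord_zero i (hn ▸ hi)]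
  · by_cases hi : i ∈ cellIndices c
    · exact le_antisymm (hwle hx hxB hy hyB h hn hp i hi)
        (hwle hy hyB hx hxB h.symm hn.symm (fun i hi => (hp i (hA ▸ hi)).symm) i (hA ▸ hi))
    · rw [mem_cellIndices, not_lt] at hi
      rw [hx.weight_zero i hi, hy.weight_zero i (hn ▸ hi)]

/-- Every measure of `finiteLevel N` lies in the interior of a cell. -/
theorem exists_inCell {S : Finset HilbertCube} (hS : S.Nonempty) {c : HilbertCube → ℝ}
    {x₀ : HilbertCube} (h : IsGapMass S c x₀) (hN : S.card ≤ N)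
    (hS0 : ∀ x ∈ S, ∀ l, N ≤ l → x l = 0) :
    ∃ (d : CellType N) (x : CellSpace N), InCell d x ∧ x ∉ cellBoundary d ∧
      weightedComb (cellWeight x) (cellPoint x) = maxPlusComb S hS c := by
  classical
  set n := S.card with hn
  have hnpos : 0 < n := hS.card_pos
  -- The lexicographically increasing enumeration of the support.
  let e := (S.map (toLex (α := HilbertCube)).toEmbedding).orderEmbOfFin (k := n) (by simp [hn])
  have heS : ∀ i, ofLex (e i) ∈ S := fun i => by
    have := Finset.orderEmbOfFin_mem (S.map (toLex (α := HilbertCube)).toEmbedding) (k := n)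
      (by simp [hn]) i
    obtain ⟨z, hz, hze⟩ := Finset.mem_map.1 this
    have : e i = toLex z := hze.symm
    rw [this]
    exact hz
  have hsurj : ∀ z ∈ S, ∃ i, ofLex (e i) = z := fun z hz => by
    have := Finset.range_orderEmbOfFin (S.map (toLex (α := HilbertCube)).toEmbedding) (k := n)
      (by simp [hn])
    have hz' : toLex z ∈ range e := by
      rw [this]
      simpa using hz
    obtain ⟨i, hi⟩ := hz'
    exact ⟨i, by rw [hi]; rfl⟩
  let p : Fin N → HilbertCube := fun i => if hi : (i : ℕ) < n then ofLex (e ⟨i, hi⟩) else 0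
  have hp : ∀ i : Fin N, ∀ hi : (i : ℕ) < n, p i = ofLex (e ⟨i, hi⟩) := fun i hi => dif_pos hi
  have hp0 : ∀ i : Fin N, n ≤ i → p i = 0 := fun i hi => dif_neg (not_lt.2 hi)
  have hpS : ∀ i : Fin N, (i : ℕ) < n → p i ∈ S := fun i hi => by
    rw [hp i hi]
    exact heS _
  have hpl : ∀ i l, N ≤ l → p i l = 0 := fun i l hl => by
    by_cases hi : (i : ℕ) < n
    · exact hS0 _ (hpS i hi) l hl
    · rw [hp0 i (not_lt.1 hi)]
      rfl
  have hpsurj : ∀ z ∈ S, ∃ i : Fin N, (i : ℕ) < n ∧ p i = z := fun z hz => by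
    obtain ⟨i, hi⟩ := hsurj z hz
    exact ⟨⟨i, i.2.trans_le hN⟩, i.2, by rw [hp _ i.2, ← hi]⟩
  have hplt : ∀ i j : Fin N, i < j → (j : ℕ) < n → toLex (p i) < toLex (p j) := by
    intro i j hij hj
    have hi : (i : ℕ) < n := lt_trans hij hj
    rw [hp i hi, hp j hj]
    exact e.strictMono (show (⟨i, hi⟩ : Fin n) < ⟨j, hj⟩ from hij)
  have hpinj : ∀ i j : Fin N, (i : ℕ) < n → (j : ℕ) < n → p i = p j → i = j := by
    intro i j hi hj hij
    rcases lt_trichotomy i j with h | h | h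
    · have := hplt i j h hj
      rw [hij] at this
      exact absurd this (lt_irrefl _)
    · exact h
    · have := hplt j i h hi
      rw [hij] at this
      exact absurd this (lt_irrefl _)
  -- Distinct points differ before the index `N`, since all later coordinates vanish; equal points
  -- have first difference 0, which is below `N` because `Fin N` has an element.
  have hfd : ∀ i j, PiNat.firstDiff (p i) (p j) < N := fun i j => by
    by_cases hij : p i = p j
    · rw [hij, PiNat.firstDiff_self_eq_zero]
      exact i.pos
    · by_contra! hle
      exact PiNat.apply_firstDiff_ne hij (by rw [hpl i _ hle, hpl j _ hle])
  obtain ⟨b, hbn, hb⟩ := hpsurj x₀ h.mem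
  let κ : Fin N → Fin N → Fin N := fun i j =>
    if (i : ℕ) < n ∧ (j : ℕ) < n then ⟨PiNat.firstDiff (p i) (p j), hfd i j⟩ else ⟨0, b.pos⟩
  have hκ : ∀ i j : Fin N, (i : ℕ) < n → (j : ℕ) < n →
      (κ i j : ℕ) = PiNat.firstDiff (p i) (p j) := fun i j hi hj => by simp [κ, hi, hj]
  let s : Fin N → ℝ := fun i => if (i : ℕ) < n then Real.exp (c (p i)) else 0
  have hs : ∀ i : Fin N, (i : ℕ) < n → s i = Real.exp (c (p i)) := fun i hi => if_pos hi
  have hs0 : ∀ i : Fin N, n ≤ i → s i = 0 := fun i hi => if_neg (not_lt.2 hi)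
  have hsnn : ∀ i, 0 ≤ s i := fun i => by
    by_cases hi : (i : ℕ) < n
    · rw [hs i hi]
      exact (Real.exp_pos _).le
    · rw [hs0 i (not_lt.1 hi)]
  let x : CellSpace N := WithLp.toLp 2 (Sum.elim (fun k => (p k.1 k.2 : ℝ)) s)
  have hxl : ∀ i l, x (Sum.inl (i, l)) = p i l := fun _ _ => rfl
  have hxr : ∀ i, x (Sum.inr i) = s i := fun _ => rfl
  let d : CellType N := (⟨n, Nat.lt_succ_of_le hN⟩, κ, b)
  have hd1 : (d.1 : ℕ) = n := rfl
  have hord : ∀ i j : Fin N, i < j → (j : ℕ) < n → p i (κ i j) < p j (κ i j) := by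
    intro i j hij hj
    obtain ⟨k, hk1, hk2⟩ := hplt i j hij hj
    have : (κ i j : ℕ) = k := by
      rw [hκ i j (lt_trans hij hj) hj]
      exact PiNat.firstDiff_eq_of hk2.ne hk1
    rw [this]
    exact hk2
  have hx : InCell d x :=
    { base_lt := hbn
      diff_symm := fun i j => by
        refine Fin.ext ?_
        by_cases hij : (i : ℕ) < n ∧ (j : ℕ) < n
        · exact (hκ i j hij.1 hij.2).trans
            ((PiNat.firstDiff_comm _ _).trans (hκ j i hij.2 hij.1).symm)
        · have hji : ¬((j : ℕ) < n ∧ (i : ℕ) < n) := fun h => hij h.symm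
          change ((κ i j : Fin N) : ℕ) = (κ j i : Fin N)
          simp only [κ, if_neg hij, if_neg hji]
      diff_self := fun i => by
        by_cases hi : (i : ℕ) < n
        · exact (hκ i i hi hi).trans (PiNat.firstDiff_self_eq_zero _)
        · change ((κ i i : Fin N) : ℕ) = 0
          simp [κ, hi]
      diff_of_le := fun i j hi => by
        have hi : ¬ (i : ℕ) < n := not_lt.2 hi
        change ((κ i j : Fin N) : ℕ) = 0
        simp [κ, hi]
      coord_nonneg := fun i l => (p i l).2.1
      coord_le := fun i l => (p i l).2.2
      coord_zero := fun i hi l => by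
        rw [hxl, hp0 i hi]
        rfl
      weight_nonneg := hsnn
      weight_base := by
        change s b = 1
        rw [hs b hbn, hb, h.base, Real.exp_zero]
      weight_gap := fun i hi => by
        rw [hxr, hd1]
        by_cases hin : (i : ℕ) < n
        · have hne : p i ≠ x₀ := fun e => hi (hpinj i b hin hbn (e.trans hb.symm))
          have h1 := Real.exp_le_exp.2 (h.gap _ (hpS i hin) hne)
          rw [Real.exp_neg, Real.exp_log (by positivity), ← hn] at h1
          rw [hs i hin]
          calc Real.exp (c (p i)) * ((n : ℝ) + 1) ≤ ((n : ℝ) + 1)⁻¹ * ((n : ℝ) + 1) := by gcongr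
            _ = 1 := inv_mul_cancel₀ (by positivity)
        · rw [hs0 i (not_lt.1 hin), zero_mul]
          exact zero_le_one
      weight_zero := hs0
      coord_eq := fun i j hij hj l hl => by
        rw [hxl, hxl]
        have hl' : (l : ℕ) < κ i j := hl
        rw [hκ i j (lt_trans hij hj) hj] at hl'
        rw [PiNat.apply_eq_of_lt_firstDiff hl']
      coord_mono := fun i j hij hj => (hord i j hij hj).le }
  have hcp : ∀ i, cellPoint x i = p i := fun i => by
    funext l
    by_cases hl : l < N
    · exact Subtype.ext (hx.coe_cellPoint i ⟨l, hl⟩)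
    · rw [cellPoint_of_le x i (not_lt.1 hl), hpl i l (not_lt.1 hl)]
  refine ⟨d, x, hx, (notMem_cellBoundary_iff hx).2 ⟨fun i j hij hj => hord i j hij hj,
    fun i hi => ?_⟩, weightedComb_eq_maxPlusComb hsnn (fun i hi => ?_) fun z hz => ?_⟩
  · rw [hxr, hs i hi]
    exact Real.exp_pos _
  · have hin : (i : ℕ) < n := by
      by_contra hin
      have : cellWeight x i = 0 := hs0 i (not_lt.1 hin)
      exact hi.ne' this
    rw [hcp]
    exact ⟨hpS i hin, (hs i hin).le⟩
  · obtain ⟨i, hi, rfl⟩ := hpsurj z hz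
    exact ⟨i, hcp i, (hs i hi).ge⟩

theorem finiteLevel_eq (N : ℕ) : finiteLevel N = ⋃ c : CellType N, cellMap '' cellSet c := by
  ext μ
  simp only [mem_iUnion]
  constructor
  · rintro ⟨S, hS, c, x₀, h1, h2, h3, h4⟩
    obtain ⟨d, x, hx, -, hxμ⟩ := exists_inCell hS h1 h2 h3
    exact ⟨d, x, hx, Subtype.ext (by rw [hx.coe_cellMap, hxμ, h4])⟩
  · rintro ⟨d, x, hx, rfl⟩
    have hx : InCell d x := hx
    obtain ⟨S, hS, c, h1, h2, h3⟩ := hx.isGapWeight.exists_isGapMass (cellPoint x)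
    refine ⟨S, hS, c, _, h1, ?_, fun z hz l hl => ?_, by rw [hx.coe_cellMap, h2]⟩
    · rw [← Set.ncard_coe_finset, h3]
      refine (Set.ncard_image_le (Set.toFinite _)).trans ?_
      refine (Set.ncard_le_ncard (Set.subset_univ _)).trans ?_
      simp
    · have hz' : z ∈ cellPoint x '' Function.support (cellWeight x) := by
        rw [← h3]
        exact hz
      obtain ⟨i, -, rfl⟩ := hz'
      exact cellPoint_of_le x i hl

/-- Each boundary point of a cell gives a measure of the same level, hence one in some open cell.
The rank of that open cell can be read off the support, so it is smaller. -/
theorem isANE_finiteLevel (N : ℕ) : IsANE.{u} (finiteLevel N) := by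
  rw [finiteLevel_eq]
  refine isANE_iUnion_cells cellRank cellSet cellBoundary (fun _ => cellMap) isCompact_cellSet
    convex_cellSet isANE_cellBoundary isClosed_cellBoundary cellBoundary_subset
    continuousOn_cellMap (fun c c' x hx y hy h => hx.1.eq_of_cellMap_eq hx.2 hy.1 hy.2 h) ?_
  intro c x hxB
  have hx : InCell c x := cellBoundary_subset c hxB
  have hmem : cellMap x ∈ finiteLevel N := by
    rw [finiteLevel_eq]
    exact mem_iUnion.2 ⟨c, x, hx, rfl⟩
  obtain ⟨S, hS, c₁, x₀, h1, h2, h3, h4⟩ := hmem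
  obtain ⟨d, y, hy, hyB, hyμ⟩ := exists_inCell hS h1 h2 h3
  have heq : cellMap x = cellMap y := Subtype.ext (by rw [h4, hy.coe_cellMap, hyμ])
  refine ⟨d, ?_, y, ⟨hy, hyB⟩, heq⟩
  rw [← hy.supportRank_eq hyB, ← hx.cellSupport_eq hy heq]
  exact hx.supportRank_lt hxB

end CellStructure

/-! ### Deforming I_f of the Hilbert cube into its finite levels -/

section HilbertCubeDeformation

open Filter

/-- The absolute value keeps the rule weight-lowering for every real parameter, as the homotopy in
`isANE_univ_of_deformations` is defined on all of ℝ. -/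
theorem isReweighting_sub (t : ℝ) :
    IsReweighting fun (_ : HilbertCube) s => max (s - |t|) 0 :=
  ⟨fun _ _ _ _ => le_max_right _ _,
    fun _ s hs _ => max_le (by linarith [abs_nonneg t]) hs,
    fun _ s s' _ h _ => max_le_max (by linarith) le_rfl⟩

/-- The maps of the Hilbert cube which kill more and more coordinates as `t` grows. -/
noncomputable def cubeShrink (t : ℝ) (x : HilbertCube) : HilbertCube :=
  -- The factor is clamped to 1 at `t = 0` and vanishes once `(l + 1) * |t| ≥ 2`.
  fun l => projIcc 0 1 zero_le_one (2 - ((l : ℝ) + 1) * |t|) * x l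

theorem cubeShrink_zero (x : HilbertCube) : cubeShrink 0 x = x := by
  funext l
  rw [cubeShrink, abs_zero, mul_zero, sub_zero, projIcc_of_right_le zero_le_one one_le_two]
  exact one_mul _

theorem continuous_cubeShrink : Continuous fun z : ℝ × HilbertCube => cubeShrink z.1 z.2 := by
  refine continuous_pi fun l => ?_
  exact (continuous_projIcc.comp (by fun_prop)).mul (by fun_prop)

/-- The deformation of `I_f` of the Hilbert cube into measures with bounded finite support. -/
noncomputable def cubeDeform (z : ℝ × IdemMeasuresF HilbertCube) : IdemMeasuresF HilbertCube :=
  idemOp (isReweighting_sub z.1) (cubeShrink z.1) z.2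

theorem continuous_cubeDeform : Continuous cubeDeform := by
  rw [← continuousOn_univ]
  refine continuousOn_idemOp (F := fun t (_ : HilbertCube) s => max (s - |t|) 0)
    isReweighting_sub (g := cubeShrink) isOpen_univ continuous_cubeShrink.continuousOn fun ψ => ?_
  have h : Continuous fun z : ℝ × HilbertCube × ℝ => cubeShrink z.1 z.2.1 :=
    continuous_cubeShrink.comp (continuous_fst.prodMk (continuous_fst.comp continuous_snd))
  exact Continuous.mul (by fun_prop) (Real.continuous_exp.comp (ψ.continuous.comp h))

theorem cubeDeform_zero (μ : IdemMeasuresF HilbertCube) : cubeDeform (0, μ) = μ := by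
  obtain ⟨k, rfl⟩ := surjective_seqComb μ
  rw [cubeDeform, idemOp_seqComb]
  congr 1
  refine Prod.ext (Subtype.ext (funext fun i => ?_)) (funext fun i => cubeShrink_zero _)
  rcases eq_or_ne i 0 with rfl | hi
  · exact k.1.2.1.symm
  · simp only [reweight_of_ne hi, abs_zero, sub_zero]
    exact max_eq_left (k.1.2.2.1 i)

/-- At time `t ≥ 2 ^ (-n)` a weight of index `i ≥ 1` survives only if `t < 1 / (i + 2)`, and
coordinate `l` only if `(l + 1) * t < 2`. The second condition dictates the bound `2 ^ (n + 1)`. -/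
theorem cubeDeform_mem (n : ℕ) {t : ℝ} (ht : t ∈ Icc ((1 / 2 : ℝ) ^ n) 1)
    (μ : IdemMeasuresF HilbertCube) : cubeDeform (t, μ) ∈ finiteLevel (2 ^ (n + 1)) := by
  obtain ⟨k, rfl⟩ := surjective_seqComb μ
  have hpow : (0 : ℝ) < (1 / 2) ^ n := by positivity
  have ht0 : 0 < t := hpow.trans_le ht.1
  have habs : |t| = t := abs_of_pos ht0
  have h2 : (1 : ℝ) ≤ 2 ^ n * t := by
    have h := mul_le_mul_of_nonneg_left ht.1 (show (0 : ℝ) ≤ 2 ^ n by positivity)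
    rwa [← mul_pow, show (2 : ℝ) * (1 / 2) = 1 by norm_num, one_pow] at h
  let F := fun (_ : HilbertCube) s => max (s - |t|) 0
  have hsupp : Function.support (reweight F k.1.1 k.2) ⊆ Finset.range (2 ^ (n + 1)) := by
    intro i hi
    rw [Finset.coe_range, Set.mem_Iio]
    rcases eq_or_ne i 0 with rfl | hi0
    · positivity
    · have hgt : t < k.1.1 i := by
        by_contra! hle
        refine hi ?_
        rw [reweight_of_ne hi0]
        exact max_eq_right (by rw [habs]; linarith)
      have h3 := hgt.trans_le (seqWeights_le k.1.2 (Nat.one_le_iff_ne_zero.2 hi0))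
      rw [lt_div_iff₀ (by positivity)] at h3
      have h4 : (i : ℝ) < 2 ^ (n + 1) := by
        rw [pow_succ]
        nlinarith
      exact_mod_cast h4
  obtain ⟨S, hS, c, h1, h3, h4⟩ := (isGapWeight_of_mem_seqWeights
    ((isReweighting_sub t).reweight_mem k.1.2 k.2)).exists_isGapMass (cubeShrink t ∘ k.2)
  refine ⟨S, hS, c, _, h1, ?_, fun x hx l hl => ?_, ?_⟩
  · rw [← Set.ncard_coe_finset, h4]
    refine (Set.ncard_image_le ((Finset.finite_toSet _).subset hsupp)).trans ?_
    refine (Set.ncard_le_ncard hsupp (Finset.finite_toSet _)).trans ?_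
    rw [Set.ncard_coe_finset, Finset.card_range]
  · have hx' : x ∈ (cubeShrink t ∘ k.2) '' Function.support (reweight F k.1.1 k.2) := by
      rw [← h4]
      exact hx
    obtain ⟨i, -, rfl⟩ := hx'
    have hl' : (2 : ℝ) ^ (n + 1) ≤ l := by exact_mod_cast hl
    have : projIcc (0 : ℝ) 1 zero_le_one (2 - ((l : ℝ) + 1) * |t|) = 0 := by
      refine projIcc_of_le_left zero_le_one ?_
      rw [habs]
      rw [pow_succ] at hl'
      nlinarith
    simp only [Function.comp_apply, cubeShrink, this]
    exact zero_mul _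
  · rw [cubeDeform, idemOp_seqComb, ← h3]
    rfl

theorem isANE_idemMeasuresF_hilbertCube :
    IsANE.{u} (univ : Set (IdemMeasuresF HilbertCube)) := by
  have : TopologicalSpace.MetrizableSpace (IdemMeasuresF HilbertCube) :=
    metrizableSpace_idemMeasuresF
  let _ : MetricSpace (IdemMeasuresF HilbertCube) := TopologicalSpace.metrizableSpaceMetric _
  exact isANE_univ_of_deformations continuous_cubeDeform cubeDeform_zero
    (fun n => isANE_finiteLevel (2 ^ (n + 1)))
    (fun a b h => monotone_finiteLevel (Nat.pow_le_pow_right two_pos (by omega)))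
    fun n t ht μ => cubeDeform_mem n ht μ

end HilbertCubeDeformation

/-! ### Transfer from the Hilbert cube to an arbitrary ANR-compactum -/

section Retracts

open Filter

theorem IsAR.isANR {X : Type u} [TopologicalSpace X] (h : IsAR X) : IsANR X := by
  refine ⟨h.1, fun Y _ _ e he => ?_⟩
  obtain ⟨r, h1, h2, h3⟩ := h.2 Y e he
  exact ⟨univ, isOpen_univ, subset_univ _, r, h1.continuousOn, fun y _ => h2 y, h3⟩

/-- Extend the inverse of the embedding to a neighbourhood and compose with the embedding. -/
theorem isANR_of_isANE_univ {X : Type u} [TopologicalSpace X]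
    [TopologicalSpace.MetrizableSpace X] (h : IsANE.{u} (univ : Set X)) : IsANR X := by
  classical
  refine ⟨inferInstance, fun Y _ _ e he => ?_⟩
  rcases isEmpty_or_nonempty X with hX | hX
  · exact ⟨∅, isOpen_empty, by simp [hX], id, by simp, by simp, by simp⟩
  have hinv : ∀ x, Function.invFun e (e x) = x := Function.leftInverse_invFun he.injective
  have hcont : ContinuousOn (Function.invFun e) (range e) := by
    rintro _ ⟨x, rfl⟩
    rw [ContinuousWithinAt, ← image_univ, ← he.isEmbedding.map_nhdsWithin_eq, hinv,
      nhdsWithin_univ, tendsto_map'_iff]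
    exact tendsto_id.congr fun z => (hinv z).symm
  obtain ⟨U, hU, hAU, F, hF, -, hFe⟩ := h Y (range e) (Function.invFun e) he.isClosed_range hcont
    fun _ _ => mem_univ _
  refine ⟨U, hU, hAU, fun y => e (F y), he.continuous.comp_continuousOn hF,
    fun y _ => mem_range_self _, ?_⟩
  rintro _ ⟨x, rfl⟩
  change e (F (e x)) = e x
  rw [hFe (mem_range_self x), hinv]

/-- A neighbourhood retract of an absolute neighbourhood extensor, in the form of maps `j` and `R`
with `R ∘ j = id`, is an absolute neighbourhood extensor. -/
theorem IsANE.of_retract {X : Type*} [TopologicalSpace X] {M : Type*} [TopologicalSpace M]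
    (h : IsANE.{u} (univ : Set M)) {j : X → M} (hj : Continuous j) {R : M → X} {Ω : Set M}
    (hΩ : IsOpen Ω) (hR : ContinuousOn R Ω) (hjΩ : ∀ x, j x ∈ Ω) (hRj : ∀ x, R (j x) = x) :
    IsANE.{u} (univ : Set X) := by
  intro Y _ _ A f hA hf _
  obtain ⟨U, hU, hAU, F, hF, -, hFf⟩ := h Y A (j ∘ f) hA (hj.comp_continuousOn hf)
    fun _ _ => mem_univ _
  refine ⟨U ∩ F ⁻¹' Ω, hF.isOpen_inter_preimage hU hΩ, fun y hy => ⟨hAU hy, ?_⟩, R ∘ F,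
    hR.comp (hF.mono inter_subset_left) fun y hy => hy.2, fun _ _ => mem_univ _, fun y hy => ?_⟩
  · rw [mem_preimage, hFf hy]
    exact hjΩ _
  · simp only [Function.comp_apply, hFf hy, hRj]

theorem exists_isClosedEmbedding_hilbertCube (X : Type*) [TopologicalSpace X] [CompactSpace X]
    [TopologicalSpace.MetrizableSpace X] : ∃ j : X → HilbertCube, IsClosedEmbedding j := by
  let _ : MetricSpace X := TopologicalSpace.metrizableSpaceMetric X
  refine ⟨fun x n => Metric.PiNatEmbed.distDenseSeq X n x, ?_⟩
  have hc : Continuous fun (x : X) n => Metric.PiNatEmbed.distDenseSeq X n x :=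
    continuous_pi fun n => Metric.PiNatEmbed.continuous_distDenseSeq n
  refine hc.isClosedEmbedding fun x y hxy => ?_
  by_contra hne
  obtain ⟨n, hn⟩ := Metric.PiNatEmbed.separation
    (isOpen_compl_singleton.mem_nhds (show x ∈ ({y} : Set X)ᶜ from hne))
  have hxy' : Metric.PiNatEmbed.distDenseSeq X n x = Metric.PiNatEmbed.distDenseSeq X n y :=
    congrFun hxy n
  rw [hxy'] at hn
  exact (mem_of_mem_nhds (x := Metric.PiNatEmbed.distDenseSeq X n y)
    (Filter.mem_comap.1 hn).choose_spec.1 |> (Filter.mem_comap.1 hn).choose_spec.2) rfl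

/-- A nonempty compact absolute neighbourhood retract embedded in the Hilbert cube is a
neighbourhood retract there. -/
theorem IsANR.exists_retraction {X : Type u} [TopologicalSpace X] [CompactSpace X] [Nonempty X]
    (h : IsANR X) {j : X → HilbertCube} (hj : IsClosedEmbedding j) :
    ∃ (U : Set HilbertCube) (r : HilbertCube → X), IsOpen U ∧ range j ⊆ U ∧ ContinuousOn r U ∧
      ∀ x, r (j x) = x := by
  -- The ANR property only tests ambient spaces in `Type u`, so the cube is lifted to that universe.
  have he : IsClosedEmbedding fun x => ULift.up.{u} (j x) :=
    Homeomorph.ulift.symm.isClosedEmbedding.comp hj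
  have : TopologicalSpace.MetrizableSpace (ULift.{u} HilbertCube) :=
    Homeomorph.ulift.isEmbedding.metrizableSpace
  obtain ⟨U, hU, hjU, ρ, hρ, hρU, hρid⟩ := h.2 (ULift.{u} HilbertCube) _ he
  have hcont : ContinuousOn (fun y => Function.invFun (fun x => ULift.up.{u} (j x)) (ρ y)) U := by
    have : ContinuousOn (Function.invFun (fun x => ULift.up.{u} (j x)))
        (range fun x => ULift.up.{u} (j x)) := by
      rintro _ ⟨x, rfl⟩
      rw [ContinuousWithinAt, ← image_univ, ← he.isEmbedding.map_nhdsWithin_eq,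
        Function.leftInverse_invFun he.injective x, nhdsWithin_univ, tendsto_map'_iff]
      exact tendsto_id.congr fun z => (Function.leftInverse_invFun he.injective z).symm
    exact this.comp hρ hρU
  refine ⟨ULift.up ⁻¹' U, fun y => Function.invFun (fun x => ULift.up.{u} (j x)) (ρ (ULift.up y)),
    hU.preimage continuous_uliftUp, ?_, hcont.comp continuous_uliftUp.continuousOn fun y hy => hy,
    fun x => ?_⟩
  · rintro _ ⟨x, rfl⟩
    exact hjU (mem_range_self x)
  · change Function.invFun (fun x => ULift.up.{u} (j x)) (ρ (ULift.up (j x))) = x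
    rw [hρid _ (mem_range_self x)]
    exact Function.leftInverse_invFun he.injective x

theorem isReweighting_mul {X : Type*} {a : X → ℝ} (ha : ∀ x, a x ∈ Icc (0 : ℝ) 1) :
    IsReweighting fun x s => a x * s :=
  ⟨fun x _ hs _ => mul_nonneg (ha x).1 hs, fun x _ hs _ => mul_le_of_le_one_left hs (ha x).2,
    fun x _ _ _ h _ => mul_le_mul_of_nonneg_left h (ha x).1⟩

/-- `J` pushes measures forward along the embedding and `R` undoes it near the image: move by `r`,
after weighting the points other than the base point by the cutoff `a`. On the image of `j` the
cutoff is 1, so `R ∘ J` is the identity. -/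
theorem isANE_idemMeasuresF {X : Type u} [TopologicalSpace X] [CompactSpace X] (h : IsANR X) :
    IsANE.{u} (univ : Set (IdemMeasuresF X)) := by
  have := h.1
  rcases isEmpty_or_nonempty X with hX | hX
  · have hempty : (univ : Set (IdemMeasuresF X)) = ∅ :=
      eq_empty_of_forall_notMem fun μ _ => hX.false (idemBase μ)
    rw [hempty]
    exact isANE_empty
  obtain ⟨j, hj⟩ := exists_isClosedEmbedding_hilbertCube X
  obtain ⟨U, r, hU, hjU, hr, hrj⟩ := h.exists_retraction hj
  obtain ⟨V, hV, hjV, hVU⟩ := normal_exists_closure_subset hj.isClosed_range hU hjU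
  obtain ⟨a, ha0, ha1, ha⟩ := exists_continuous_zero_one_of_isClosed hV.isClosed_compl
    hj.isClosed_range (disjoint_compl_left_iff_subset.2 hjV)
  have hone : IsReweighting fun (_ : X) (s : ℝ) => s :=
    ⟨fun _ _ hs _ => hs, fun _ _ _ _ => le_rfl, fun _ _ _ _ h _ => h⟩
  let J : IdemMeasuresF X → IdemMeasuresF HilbertCube := idemOp hone j
  have hJ : ∀ k, J (seqComb k) =
      seqComb (⟨reweight (fun (_ : X) s => s) k.1.1 k.2, hone.reweight_mem k.1.2 k.2⟩, j ∘ k.2) :=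
    fun k => idemOp_seqComb hone j k
  have hJc : Continuous J := by
    rw [← continuousOn_univ]
    exact continuousOn_idemOp_fixed hone isOpen_univ hj.continuous.continuousOn
      fun ψ => Continuous.mul (by fun_prop) (Real.continuous_exp.comp (ψ.continuous.comp
        (hj.continuous.comp continuous_fst)))
  -- Only the base point is confined to `U`; other support points may lie anywhere, since `a`
  -- deletes those outside `V`.
  let Ω : Set (IdemMeasuresF HilbertCube) := idemBase ⁻¹' U
  have hΩ : IsOpen Ω := hU.preimage continuous_idemBase
  let R : IdemMeasuresF HilbertCube → IdemMeasuresF X := idemOp (isReweighting_mul ha) r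
  have hRc : ContinuousOn R Ω := by
    refine continuousOn_idemOp_fixed (isReweighting_mul ha) hΩ
      (hr.mono (image_preimage_subset _ _)) fun ψ => ?_
    rw [continuous_iff_continuousAt]
    rintro ⟨x, s⟩
    by_cases hx : x ∈ U
    · have h1 : ContinuousAt (fun z : HilbertCube × ℝ => r z.1) (x, s) :=
        ContinuousAt.comp (g := r) (f := fun z : HilbertCube × ℝ => z.1)
          (hr.continuousAt (hU.mem_nhds hx)) continuousAt_fst
      have h2 : Continuous fun z : HilbertCube × ℝ => a z.1 * z.2 :=
        (a.continuous.comp continuous_fst).mul continuous_snd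
      exact h2.continuousAt.mul ((Real.continuous_exp.comp ψ.continuous).continuousAt.comp h1)
    -- Near a point outside `U` the cutoff is identically 0, so the values of `r` there are
    -- irrelevant.
    · have hxV : x ∈ (closure V)ᶜ := fun h => hx (hVU h)
      have hmem : {z : HilbertCube × ℝ | z.1 ∈ (closure V)ᶜ} ∈ 𝓝 (x, s) :=
        (isClosed_closure.isOpen_compl.preimage continuous_fst).mem_nhds hxV
      refine (continuousAt_const (y := (0 : ℝ))).congr ?_
      filter_upwards [hmem] with z hz
      have : a z.1 = 0 := ha0 fun hzV => hz (subset_closure hzV)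
      rw [this, zero_mul, zero_mul]
  refine isANE_idemMeasuresF_hilbertCube.of_retract hJc hΩ hRc ?_ ?_
  · intro μ
    obtain ⟨k, rfl⟩ := surjective_seqComb μ
    rw [hJ, mem_preimage, idemBase_seqComb]
    exact hjU (mem_range_self _)
  · intro μ
    obtain ⟨k, rfl⟩ := surjective_seqComb μ
    rw [hJ]
    refine (idemOp_seqComb (isReweighting_mul ha) r _).trans ?_
    congr 1
    refine Prod.ext (Subtype.ext (funext fun i => ?_)) (funext fun i => hrj _)
    rcases eq_or_ne i 0 with rfl | hi
    · exact k.1.2.1.symm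
    · have h1 : a (j (k.2 i)) = 1 := ha1 (mem_range_self _)
      simp only [reweight_of_ne hi, Function.comp_apply, h1, one_mul]

theorem isANRCompactum_idemMeasuresF {X : Type u} [TopologicalSpace X] (h : IsANRCompactum X) :
    IsANRCompactum (IdemMeasuresF X) := by
  have := h.1
  have := h.2.1
  have : TopologicalSpace.MetrizableSpace (IdemMeasuresF X) := metrizableSpace_idemMeasuresF
  exact ⟨inferInstance, isANR_of_isANE_univ (isANE_idemMeasuresF h.2)⟩

end Retracts

theorem theorem3 :
    (∀ (X : Type u) [TopologicalSpace X],
      IsARCompactum X ∨ IsANRCompactum X → IsANRCompactum (IdemMeasuresF X)) ∧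
    (∀ X : CompHaus.{u}, IsANRCompactum X → IsANRCompactum (idemFunctorF.obj X)) :=
  ⟨fun _ _ h => isANRCompactum_idemMeasuresF (h.elim (fun h => ⟨h.1, h.2.isANR⟩) id),
    fun _ h => isANRCompactum_idemMeasuresF h⟩
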